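/- **Theorem 1.2 (Blow-up).** Let $n\ge 1$ and $k\ge 2$ be integers, let $\sigma\ge 1$ be a real number (not necessarily an integer), and let $p_1,\dots,p_k>1$. Indices are cyclic modulo $k$, so $u_0$ as a component means $u_k$. Consider the Cauchy problem, for real-valued $u_1,\dots,u_k$, $$ \begin{cases} \partial_t^2 u_\ell+(-\Delta)^\sigma u_\ell+\partial_t u_\ell+(-\Delta)^\sigma\partial_t u_\ell=|u_{\ell-1}|^{p_\ell}, & t\ge 0,\ x\in\mathbb R^n,\\ u_\ell(0,x)=u_{0\ell}(x),\quad \partial_t u_\ell(0,x)=u_{1\ell}(x), & x\in\mathbb R^n, \end{cases} \qquad \ell=1,\dots,k, $$ where $(-\Delta)^\sigma$ is the Fourier multiplier with symbol $|\xi|^{2\sigma}$. Let $P$ be the $k\times k$ matrix with $P_{1,k}=p_1$, $P_{\ell,\ell-1}=p_\ell$ for $2\le\ell\le k$, and all other entries $0$, and let $\gamma=(\gamma_1,\dots,\gamma_k)^{\mathtt t}=(P-I)^{-1}(1,\dots,1)^{\mathtt t}$ (the matrix $P-I$ is invertible). Assume that for every $\ell=1,\dots,k$ the distribution $(I+(-\Delta)^\sigma)u_{0\ell}$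 is in $L^1(\mathbb R^n)$, that $u_{1\ell}\in L^1(\mathbb R^n)$, and that $$ \int_{\mathbb R^n}(I+(-\Delta)^\sigma)u_{0\ell}(x)\,dx>0,\qquad \int_{\mathbb R^n}u_{1\ell}(x)\,dx>0 . $$ If $$ \max\{\gamma_1,\dots,\gamma_k\}>\frac{n}{2\sigma} $$ (that is, $\gamma_k>\frac n{2\sigma}$ when the components are numbered so that $\gamma_k$ is the largest), then the Cauchy problem has no global (in time) Sobolev solution $(u_1,\dots,u_k)\in\big(C([0,\infty),L^2(\mathbb R^n))\big)^k$. Here a global Sobolev solution is a $k$-tuple of functions $u_\ell\in C([0,\infty),L^2(\mathbb R^n))$ with $u_\ell(0,\cdot)=u_{0\ell}$ and $|u_{\ell-1}|^{p_\ell}\in L^1_{\rm loc}([0,\infty)\times\mathbb R^n)$ that satisfies the problem weakly: for every $\ell$ and every real $\varphi\in C_c^\infty([0,\infty)\times\mathbb R^n)$ (not required to vanish at $t=0$), $$ \begin{aligned} &\int_0^\infty\!\!\int_{\mathbb R^n}|u_{\ell-1}|^{p_\ell}\varphi\,dx\,dt+\int_{\mathbb R^n}u_{1\ell}\,\varphi(0,\cdot)\,dx+\int_{\mathbb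 R^n}u_{0\ell}\big(\varphi+(-\Delta)^\sigma\varphi-\partial_t\varphi\big)(0,\cdot)\,dx\\ &\qquad=\int_0^\infty\!\!\int_{\mathbb R^n}u_\ell\,\big(\partial_t^2\varphi+(-\Delta)^\sigma\varphi-\partial_t\varphi-(-\Delta)^\sigma\partial_t\varphi\big)\,dx\,dt . \end{aligned} $$ -/

import Mathlib

open MeasureTheory Set
open scoped FourierTransform ContDiff Matrix

noncomputable section

/-- The fractional Laplacian `(-Δ)^σ φ` of a real function `φ` on `ℝⁿ`, i.e. the Fourier multiplier
with symbol `|ξ|^{2σ}`. With the normalization `𝓕 φ(ξ) = ∫ e^{-2πi⟨x,ξ⟩} φ(x) dx` the symbol reads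
`(2π|ξ|)^{2σ}`. For real `φ` the result is real, so that taking the real part only changes the type.
It is applied to smooth compactly supported functions only. -/
def fracLaplacian {n : ℕ} (σ : ℝ) (φ : EuclideanSpace ℝ (Fin n) → ℝ) :
    EuclideanSpace ℝ (Fin n) → ℝ :=
  fun x => (𝓕⁻ (fun ξ : EuclideanSpace ℝ (Fin n) =>
    (((2 * Real.pi * ‖ξ‖) ^ (2 * σ) : ℝ) : ℂ) *
      𝓕 (fun y : EuclideanSpace ℝ (Fin n) => (φ y : ℂ)) ξ) x).re

/-- The function `f` is `(I + (-Δ)^σ) v` in the sense of distributions. -/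
def IsDistribHelmholtz {n : ℕ} (σ : ℝ) (v f : EuclideanSpace ℝ (Fin n) → ℝ) : Prop :=
  ∀ φ : EuclideanSpace ℝ (Fin n) → ℝ, ContDiff ℝ ∞ φ → HasCompactSupport φ →
    Integrable (fun x => v x * (φ x + fracLaplacian σ φ x)) ∧
    ∫ x, v x * (φ x + fracLaplacian σ φ x) = ∫ x, f x * φ x

/-- The matrix `P` of exponents: row `ℓ` has the entry `p ℓ` in the column `ℓ - 1`, where the
indices are cyclic (so the first row has its entry in the last column), and `0` elsewhere. -/
def exponentMatrix {k : ℕ} [NeZero k] (p : Fin k → ℝ) : Matrix (Fin k) (Fin k) ℝ :=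
  Matrix.of fun ℓ j => if j = ℓ - 1 then p ℓ else 0

/-- The vector `γ = (P - I)⁻¹ (1, …, 1)ᵗ`. -/
def gammaVec {k : ℕ} [NeZero k] (p : Fin k → ℝ) : Fin k → ℝ :=
  (exponentMatrix p - 1)⁻¹ *ᵥ (fun _ => 1)

/-- `t ↦ u(t, ·)` belongs to `C([0,∞), L²(ℝⁿ))`. -/
def IsContinuousL2Curve {n : ℕ} (u : ℝ → EuclideanSpace ℝ (Fin n) → ℝ) : Prop :=
  ∃ U : ℝ → Lp ℝ 2 (volume : Measure (EuclideanSpace ℝ (Fin n))),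
    ContinuousOn U (Ici 0) ∧ ∀ t ∈ Ici (0 : ℝ), U t =ᵐ[volume] u t

/-- Weak form of the Cauchy problem
`u_tt + (-Δ)^σ u + u_t + (-Δ)^σ u_t = g`, `u(0) = v₀`, `u_t(0) = v₁` on `[0,∞) × ℝⁿ`:
multiply by a test function `φ` in `C_c^∞([0,∞) × ℝⁿ)` (a restriction of a function in
`C_c^∞(ℝ × ℝⁿ)`; no vanishing at `t = 0` is required), and move all derivatives to `φ`. -/
def IsWeakCauchySolution {n : ℕ} (σ : ℝ) (g u : ℝ → EuclideanSpace ℝ (Fin n) → ℝ)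
    (v₀ v₁ : EuclideanSpace ℝ (Fin n) → ℝ) : Prop :=
  ∀ φ : ℝ → EuclideanSpace ℝ (Fin n) → ℝ,
    ContDiff ℝ ∞ (Function.uncurry φ) → HasCompactSupport (Function.uncurry φ) →
    (∫ t in Ici (0 : ℝ), ∫ x, g t x * φ t x)
      + (∫ x, v₁ x * φ 0 x)
      + (∫ x, v₀ x * (φ 0 x + fracLaplacian σ (φ 0) x - deriv (fun s => φ s x) 0))
    = ∫ t in Ici (0 : ℝ), ∫ x, u t x *
        (iteratedDeriv 2 (fun s => φ s x) t + fracLaplacian σ (φ t) x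
          - deriv (fun s => φ s x) t
          - fracLaplacian σ (fun y => deriv (fun s => φ s y) t) x)

/-- `u = (u_1, …, u_k)` is a global in time Sobolev solution in `(C([0,∞), L²))^k` of
`∂_t² u_ℓ + (-Δ)^σ u_ℓ + ∂_t u_ℓ + (-Δ)^σ ∂_t u_ℓ = |u_{ℓ-1}|^{p_ℓ}` (indices cyclic, `u_0 = u_k`)
with the data `u_ℓ(0) = u0 ℓ`, `∂_t u_ℓ(0) = u1 ℓ`. The nonlinear terms have to be in
`L¹_loc([0,∞) × ℝⁿ)`, so that the equations make sense as distributions. -/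
structure IsGlobalSobolevSolution {n k : ℕ} [NeZero k] (σ : ℝ) (p : Fin k → ℝ)
    (u0 u1 : Fin k → EuclideanSpace ℝ (Fin n) → ℝ)
    (u : Fin k → ℝ → EuclideanSpace ℝ (Fin n) → ℝ) : Prop where
  measurable : ∀ ℓ, AEStronglyMeasurable (Function.uncurry (u ℓ))
    (volume.restrict (Ici (0 : ℝ) ×ˢ (univ : Set (EuclideanSpace ℝ (Fin n)))))
  continuous : ∀ ℓ, IsContinuousL2Curve (u ℓ)
  initial : ∀ ℓ, u ℓ 0 =ᵐ[volume] u0 ℓ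
  nonlinearity_locallyIntegrable : ∀ ℓ, LocallyIntegrableOn
    (fun z : ℝ × EuclideanSpace ℝ (Fin n) => |u (ℓ - 1) z.1 z.2| ^ p ℓ) (Ici (0 : ℝ) ×ˢ univ)
  equation : ∀ ℓ, IsWeakCauchySolution σ (fun t x => |u (ℓ - 1) t x| ^ p ℓ) (u ℓ) (u0 ℓ) (u1 ℓ)

end

/-!
The proof is the test function method at the parabolic scaling `t ~ R^{2σ}`, `x ~ R`, for which
`∂_t u + (-Δ)^σ u` is the dominant part of the operator.

The difficulty is that `(-Δ)^σ φ` is not compactly supported when `σ` is not an integer, so it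
cannot be absorbed by a compactly supported `φ`. The test functions are therefore built from the
dyadic sums `Φ_N(x) = ∑_{j<N} 2^{-j(n+1)} b(2^{-j} x)` of dilates of one bump `b`. They are smooth
and compactly supported, but as `N → ∞` they become comparable to the weight
`W(x) = (1 + |x|)^{-(n+1)}` (`dyadicProfile_le`, `exists_le_dyadicProfile`), and
`|(-Δ)^σ Φ_N| ≤ C W` uniformly in `N` (`exists_abs_fracLaplacian_dyadicProfile_le`). The last bound
follows by scaling from `|(-Δ)^σ b| ≤ C W` alone (`exists_decay_fracLaplacian`). For this decay the
symbol `|ξ|^{2σ}` is split into a smooth part of temperate growth, which maps Schwartz functions to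
Schwartz functions, and a part `m` supported in the unit ball. The difference
`m(ξ) - 2^{-2σ} m(2ξ)` is smooth and compactly supported, because the homogeneous singularity
cancels. So the inverse transform `G` of `m` satisfies
`|G(x)| ≤ C_M (1 + |x|)^{-M} + 2^{-2σ-n} |G(x/2)|`, and iterating this yields
`|G| ≤ C (1 + |x|)^{-(n+1)}` (`exists_decay_fourierInv_lowFrequency`).

Testing the `ℓ`-th equation with `η(t/R^{2σ}) Φ_N(x/R)` and letting `N → ∞` gives, for large `R`,
`c I_ℓ + δ ≤ C R^{-2σ} ∫∫ |u_ℓ| β^κ W(x/R)` with `δ > 0` coming from the data, `η = β^{κ+2}`, and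
`I_ℓ = ∫∫ |u_{ℓ-1}|^{p_ℓ} η W(x/R)` (`IsWeakCauchySolution.exists_weighted_le`). The right-hand
side is finite since `u_ℓ ∈ C([0,∞), L²)`, and Hölder's inequality bounds it by a power of
`I_{ℓ+1}`. In terms of `Z_ℓ = R^{2σγ_ℓ - n} I_ℓ` all powers of `R` cancel, exactly because
`(P - I)γ = (1, …, 1)`, and one is left with
`c Z_ℓ + δ R^{2σγ_ℓ - n} ≤ C Z_{ℓ+1}^{1/p_{ℓ+1}}`. As all `p_ℓ > 1`, this cyclic system bounds the
`Z_ℓ` independently of `R`, which is absurd as `R → ∞` if `2σγ_m > n` for some `m`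
(`not_eventually_scaled_cyclic_le`).
-/

/-! ### Decay of the kernel of a homogeneous Fourier multiplier -/

section FourierDecay

open Module SchwartzMap

variable {V : Type*} [NormedAddCommGroup V] [InnerProductSpace ℝ V]

/-- The symbol `‖ξ‖^{2σ}` can be modified inside the unit ball so as to become a smooth function of
temperate growth. It is written as `(1 + ‖ξ‖²)^σ r^σ` with `r = ‖ξ‖² / (1 + ‖ξ‖²)`, and `r^σ` is cut
off near `r = 0`. -/
theorem exists_hasTemperateGrowth_eq_norm_rpow (σ : ℝ) :
    ∃ w : V → ℝ, w.HasTemperateGrowth ∧ ∀ ξ, 1 ≤ ‖ξ‖ → w ξ = ‖ξ‖ ^ (2 * σ) := by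
  set G : ℝ → ℝ := fun r =>
    r ^ σ * (Real.smoothTransition (4 * r - 1) * Real.smoothTransition (3 - r)) with hG
  -- only `r ∈ [0, 1)` occurs; the factor `smoothTransition (3 - r)` makes `G` compactly supported,
  -- hence of temperate growth
  have hG0 : ∀ r, r ≤ 1 / 4 → G r = 0 := fun r hr => by
    simp [hG, Real.smoothTransition.zero_of_nonpos (show 4 * r - 1 ≤ 0 by linarith)]
  have hGs : ContDiff ℝ ∞ G := by
    rw [contDiff_iff_contDiffAt]
    intro r
    rcases lt_or_ge r (1 / 4) with hr | hr
    · have : G =ᶠ[nhds r] fun _ => 0 := by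
        filter_upwards [Iio_mem_nhds hr] with s hs using hG0 s hs.le
      exact contDiffAt_const.congr_of_eventuallyEq this
    · have hr0 : r ≠ 0 := by linarith
      refine (Real.contDiffAt_rpow_const_of_ne hr0).mul (ContDiffAt.mul ?_ ?_)
      · exact (Real.smoothTransition.contDiff (n := ⊤)).contDiffAt.comp r
          (f := fun r : ℝ => 4 * r - 1) (by fun_prop)
      · exact (Real.smoothTransition.contDiff (n := ⊤)).contDiffAt.comp r
          (f := fun r : ℝ => 3 - r) (by fun_prop)
  have hGc : HasCompactSupport G := by
    refine HasCompactSupport.intro (isCompact_Icc (a := (1 / 4 : ℝ)) (b := 3)) fun r hr => ?_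
    rcases lt_or_ge r (1 / 4) with h | h
    · exact hG0 r h.le
    · have h3 : 3 < r := by
        by_contra h3
        exact hr ⟨h, not_lt.1 h3⟩
      simp [hG, Real.smoothTransition.zero_of_nonpos (show 3 - r ≤ 0 by linarith)]
  have hr : (fun ξ : V => 1 - (1 + ‖ξ‖ ^ 2) ^ (-1 : ℝ)).HasTemperateGrowth :=
    (Function.HasTemperateGrowth.const 1).sub
      (Function.hasTemperateGrowth_one_add_norm_sq_rpow V (-1))
  refine ⟨fun ξ => (1 + ‖ξ‖ ^ 2) ^ σ * G (1 - (1 + ‖ξ‖ ^ 2) ^ (-1 : ℝ)),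
    (Function.hasTemperateGrowth_one_add_norm_sq_rpow V σ).mul
      ((hGc.hasTemperateGrowth hGs).comp hr), fun ξ hξ => ?_⟩
  · have h1 : 1 ≤ ‖ξ‖ ^ 2 := one_le_pow₀ hξ
    have hpos : 0 < 1 + ‖ξ‖ ^ 2 := by positivity
    have hq : 1 - (1 + ‖ξ‖ ^ 2) ^ (-1 : ℝ) = ‖ξ‖ ^ 2 / (1 + ‖ξ‖ ^ 2) := by
      rw [Real.rpow_neg_one]; field_simp; ring
    have hhalf : 1 / 2 ≤ ‖ξ‖ ^ 2 / (1 + ‖ξ‖ ^ 2) := by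
      rw [le_div_iff₀ hpos]; linarith
    have hone : ‖ξ‖ ^ 2 / (1 + ‖ξ‖ ^ 2) ≤ 1 := by
      rw [div_le_one hpos]; linarith
    simp only [hG]
    rw [hq, Real.smoothTransition.one_of_one_le (by linarith),
      Real.smoothTransition.one_of_one_le (by linarith), mul_one, mul_one,
      ← Real.mul_rpow hpos.le (by positivity), mul_div_cancel₀ _ hpos.ne', Real.rpow_mul
      (norm_nonneg _)]
    norm_num

/-- A function with `B(x) ≤ C + B(x/2)/2` is bounded everywhere if it is bounded on the unit ball,
by induction over the dyadic balls. -/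
theorem le_max_of_le_add_half_comp_half {B : V → ℝ} {C K : ℝ}
    (h : ∀ x, B x ≤ C + 1 / 2 * B ((2 : ℝ)⁻¹ • x)) (hK : ∀ x, ‖x‖ ≤ 1 → B x ≤ K) (x : V) :
    B x ≤ max (2 * C) K := by
  have key : ∀ j : ℕ, ∀ x : V, ‖x‖ ≤ 2 ^ j → B x ≤ max (2 * C) K := by
    intro j
    induction j with
    | zero => exact fun x hx => (hK x (by simpa using hx)).trans (le_max_right _ _)
    | succ j ih =>
      intro x hx
      have h1 := ih ((2 : ℝ)⁻¹ • x) (by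
        rw [norm_smul, norm_inv, Real.norm_ofNat]
        rw [pow_succ] at hx
        linarith)
      linarith [h x, le_max_left (2 * C) K]
  obtain ⟨j, hj⟩ := pow_unbounded_of_one_lt ‖x‖ (one_lt_two)
  exact key j x hj.le

theorem exists_norm_schwartz_le (f : 𝓢(V, ℂ)) (k : ℕ) :
    ∃ C, ∀ x, (1 + ‖x‖) ^ k * ‖f x‖ ≤ C := by
  have h := one_add_le_sup_seminorm_apply (𝕜 := ℝ) (m := (k, 0)) (le_refl k) (le_refl 0) f
  simp only [norm_iteratedFDeriv_zero] at h
  exact ⟨_, h⟩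

variable [FiniteDimensional ℝ V] [MeasurableSpace V] [BorelSpace V]

theorem fourierInv_comp_smul {c : ℝ} (hc : 0 < c) (f : V → ℂ) (x : V) :
    𝓕⁻ (fun ξ => f (c • ξ)) x = ((c ^ finrank ℝ V)⁻¹ : ℝ) • 𝓕⁻ f (c⁻¹ • x) := by
  rw [Real.fourierInv_eq, Real.fourierInv_eq,
    ← Measure.integral_comp_smul_of_nonneg volume _ c (hR := hc.le)]
  simp only [inner_smul_left, inner_smul_right, RCLike.conj_to_real,
    inv_mul_cancel_left₀ hc.ne']

theorem fourier_comp_smul {c : ℝ} (hc : 0 < c) (f : V → ℂ) (ξ : V) :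
    𝓕 (fun x => f (c • x)) ξ = ((c ^ finrank ℝ V)⁻¹ : ℝ) • 𝓕 f (c⁻¹ • ξ) := by
  rw [Real.fourier_eq, Real.fourier_eq,
    ← Measure.integral_comp_smul_of_nonneg volume _ c (hR := hc.le)]
  simp only [inner_smul_left, inner_smul_right, RCLike.conj_to_real,
    inv_mul_cancel_left₀ hc.ne']

theorem fourierInv_add_of_integrable {f g : V → ℂ} (hf : Integrable f) (hg : Integrable g)
    (x : V) : 𝓕⁻ (fun ξ => f ξ + g ξ) x = 𝓕⁻ f x + 𝓕⁻ g x := by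
  simp only [Real.fourierInv_eq, smul_add]
  refine integral_add ?_ ?_
  · simpa using (Real.fourierIntegral_convergent_iff (-x)).2 hf
  · simpa using (Real.fourierIntegral_convergent_iff (-x)).2 hg

theorem fourierInv_const_mul (c : ℂ) (f : V → ℂ) (x : V) :
    𝓕⁻ (fun ξ => c * f ξ) x = c * 𝓕⁻ f x := by
  simp only [Real.fourierInv_eq, ← integral_const_mul, mul_smul_comm]

theorem norm_fourierInv_le_integral_norm (f : V → ℂ) (x : V) : ‖𝓕⁻ f x‖ ≤ ∫ ξ, ‖f ξ‖ := by
  rw [Real.fourierInv_eq]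
  refine (norm_integral_le_integral_norm _).trans (le_of_eq ?_)
  simp

/-- The Fourier multiplier `m` is the convolution with `𝓕⁻ m`. -/
theorem fourierInv_mul_fourier {m g : V → ℂ} (hm : Integrable m) (hg : Integrable g) (x : V) :
    𝓕⁻ (fun ξ => m ξ * 𝓕 g ξ) x = ∫ y, g y * 𝓕⁻ m (x - y) := by
  have h := VectorFourier.integral_fourierIntegral_smul_eq_flip (L := innerₗ V)
    (μ := volume) (ν := volume) Real.continuous_fourierChar continuous_inner hg
    ((Real.fourierIntegral_convergent_iff (-x)).2 hm)
  rw [Real.fourierInv_eq]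
  calc _ = ∫ ξ, (𝓕 g ξ) • (Real.fourierChar (-(inner ℝ ξ (-x))) • m ξ) := by
        refine integral_congr_ae (.of_forall fun ξ => ?_)
        simp only [inner_neg_right, neg_neg, Circle.smul_def, smul_eq_mul]
        ring
    _ = _ := by
        refine h.trans (integral_congr_ae (.of_forall fun y => ?_))
        simp only [smul_eq_mul]
        congr 1
        rw [Real.fourierInv_eq, VectorFourier.fourierIntegral]
        refine integral_congr_ae (.of_forall fun ξ => ?_)
        simp only [smul_smul, ← AddChar.map_add_eq_mul]
        congr 2
        simp [inner_sub_right, real_inner_comm]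
        ring

/-- The singular part `‖ξ‖^{2σ} - w(ξ)` of the symbol is supported in the unit ball, and its inverse
Fourier transform decays like `‖x‖^{-(d+1)}`: it is reproduced by the dilation `x ↦ x/2` up to a
Schwartz function and with a factor that is small enough even after multiplying by the growth of
the weight. -/
theorem exists_decay_fourierInv_lowFrequency {σ : ℝ} (hσ : 1 ≤ σ) {w : V → ℝ}
    (hw : w.HasTemperateGrowth) (hw1 : ∀ ξ, 1 ≤ ‖ξ‖ → w ξ = ‖ξ‖ ^ (2 * σ)) :
    Integrable (fun ξ : V => ((‖ξ‖ ^ (2 * σ) - w ξ : ℝ) : ℂ)) ∧ ∃ C, ∀ x,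
      (1 + ‖x‖) ^ (finrank ℝ V + 1) *
        ‖𝓕⁻ (fun ξ : V => ((‖ξ‖ ^ (2 * σ) - w ξ : ℝ) : ℂ)) x‖ ≤ C := by
  set d := finrank ℝ V with hd
  set m : V → ℂ := fun ξ => ((‖ξ‖ ^ (2 * σ) - w ξ : ℝ) : ℂ) with hm
  have hm0 : ∀ ξ, 1 ≤ ‖ξ‖ → m ξ = 0 := fun ξ h => by simp [hm, hw1 ξ h]
  have hmc : Continuous m := by
    refine Complex.continuous_ofReal.comp (Continuous.sub ?_ hw.1.continuous)
    exact continuous_norm.rpow_const fun _ => Or.inr (by linarith)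
  have hms : HasCompactSupport m :=
    HasCompactSupport.intro (isCompact_closedBall (0 : V) 1) fun ξ hξ => hm0 ξ (by
      simpa using (not_le.1 (by simpa using hξ)).le)
  have hmi : Integrable m := hmc.integrable_of_hasCompactSupport hms
  refine ⟨hmi, ?_⟩
  set c : ℝ := 2 ^ (-(2 * σ)) with hc
  have hcpos : 0 < c := by positivity
  have hc4 : c ≤ 1 / 4 := by
    rw [hc, Real.rpow_neg zero_le_two]
    have : (2 : ℝ) ^ (2 : ℝ) ≤ 2 ^ (2 * σ) :=
      Real.rpow_le_rpow_of_exponent_le one_le_two (by linarith)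
    rw [one_div]
    exact inv_anti₀ (by norm_num) (by norm_num at this; linarith)
  have hcc : c * 2 ^ (2 * σ) = 1 := by
    rw [hc, ← Real.rpow_add two_pos]; simp
  -- the dyadic difference of the symbol is smooth: the singular powers of `‖ξ‖` cancel
  set S : V → ℂ := fun ξ => m ξ - c * m ((2 : ℝ) • ξ) with hS
  have hS' : S = fun ξ => ((c * w ((2 : ℝ) • ξ) - w ξ : ℝ) : ℂ) := by
    funext ξ
    simp only [hS, hm, norm_smul, Real.norm_ofNat]
    rw [Real.mul_rpow zero_le_two (norm_nonneg _), ← Complex.ofReal_mul, ← Complex.ofReal_sub]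
    congr 1
    linear_combination (-(‖ξ‖ ^ (2 * σ))) * hcc
  have hSs : ContDiff ℝ ∞ S := by
    rw [hS']
    have := hw.1
    exact Complex.ofRealCLM.contDiff.comp
      ((contDiff_const.mul (this.comp (contDiff_const_smul 2))).sub this)
  have hSc : HasCompactSupport S :=
    HasCompactSupport.intro (isCompact_closedBall (0 : V) 1) fun ξ hξ => by
      have h1 : 1 ≤ ‖ξ‖ := by simpa using (not_le.1 (by simpa using hξ)).le
      have h2 : 1 ≤ ‖(2 : ℝ) • ξ‖ := by rw [norm_smul, Real.norm_ofNat]; linarith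
      simp [hS, hm0 ξ h1, hm0 _ h2]
  obtain ⟨C, hC⟩ := exists_norm_schwartz_le (𝓕⁻ (hSc.toSchwartzMap hSs)) (d + 1)
  have hrel : ∀ x, 𝓕⁻ m x = 𝓕⁻ S x + (c * ((2 : ℝ) ^ d)⁻¹ : ℝ) • 𝓕⁻ m ((2 : ℝ)⁻¹ • x) := by
    intro x
    have h1 : m = fun ξ => S ξ + c * m ((2 : ℝ) • ξ) := by funext ξ; simp [hS]
    conv_lhs => rw [h1]
    rw [fourierInv_add_of_integrable (hSs.continuous.integrable_of_hasCompactSupport hSc)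
      ((hmi.comp_smul two_ne_zero).const_mul _), fourierInv_const_mul,
      fourierInv_comp_smul two_pos, ← hd]
    simp [mul_assoc]
  refine ⟨_, le_max_of_le_add_half_comp_half (C := C) (K := 2 ^ (d + 1) * ∫ ξ, ‖m ξ‖) ?_ ?_⟩
  · intro x
    have hCx : (1 + ‖x‖) ^ (d + 1) * ‖𝓕⁻ S x‖ ≤ C := by
      have := hC x
      rwa [SchwartzMap.fourierInv_coe] at this
    have hn : ‖𝓕⁻ m x‖ ≤ ‖𝓕⁻ S x‖ + c * ((2 : ℝ) ^ d)⁻¹ * ‖𝓕⁻ m ((2 : ℝ)⁻¹ • x)‖ := by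
      rw [hrel x]
      refine (norm_add_le _ _).trans (le_of_eq ?_)
      rw [norm_smul, Real.norm_of_nonneg (by positivity)]
    have hx : (1 + ‖x‖) ^ (d + 1) ≤ 2 ^ (d + 1) * (1 + ‖(2 : ℝ)⁻¹ • x‖) ^ (d + 1) := by
      rw [← mul_pow]
      refine pow_le_pow_left₀ (by positivity) ?_ _
      rw [norm_smul, norm_inv, Real.norm_ofNat]
      linarith
    set a := ‖𝓕⁻ m ((2 : ℝ)⁻¹ • x)‖
    set b := (1 + ‖(2 : ℝ)⁻¹ • x‖) ^ (d + 1)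
    calc (1 + ‖x‖) ^ (d + 1) * ‖𝓕⁻ m x‖
        ≤ (1 + ‖x‖) ^ (d + 1) * (‖𝓕⁻ S x‖ + c * ((2 : ℝ) ^ d)⁻¹ * a) := by gcongr
      _ = (1 + ‖x‖) ^ (d + 1) * ‖𝓕⁻ S x‖
          + (1 + ‖x‖) ^ (d + 1) * (c * ((2 : ℝ) ^ d)⁻¹ * a) := by ring
      _ ≤ C + 2 ^ (d + 1) * b * (1 / 4 * ((2 : ℝ) ^ d)⁻¹ * a) := by gcongr
      _ = C + 1 / 2 * (b * a) := by
        rw [pow_succ]; field_simp; ring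
  · intro x hx
    have : 1 + ‖x‖ ≤ 2 := by linarith
    have := norm_fourierInv_le_integral_norm m x
    gcongr

/-- The Fourier multiplier `‖ξ‖^{2σ}`, `σ ≥ 1`, maps a Schwartz function to a function that decays
like `‖x‖^{-(d+1)}`. -/
theorem exists_decay_fourierInv_norm_rpow_mul_fourier {σ : ℝ} (hσ : 1 ≤ σ) (g : 𝓢(V, ℂ)) :
    Integrable (fun ξ : V => ((‖ξ‖ ^ (2 * σ) : ℝ) : ℂ) * 𝓕 g ξ) ∧ ∃ C, ∀ x,
      (1 + ‖x‖) ^ (finrank ℝ V + 1) *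
        ‖𝓕⁻ (fun ξ : V => ((‖ξ‖ ^ (2 * σ) : ℝ) : ℂ) * 𝓕 g ξ) x‖ ≤ C := by
  obtain ⟨w, hw, hw1⟩ := exists_hasTemperateGrowth_eq_norm_rpow (V := V) σ
  obtain ⟨hmi, C₁, hC₁⟩ := exists_decay_fourierInv_lowFrequency hσ hw hw1
  set d := finrank ℝ V with hd
  -- low frequencies `m`, a convolution with a decaying kernel, and a Schwartz remainder `H`
  set m : V → ℂ := fun ξ => ((‖ξ‖ ^ (2 * σ) - w ξ : ℝ) : ℂ) with hm
  set H : 𝓢(V, ℂ) := smulLeftCLM ℂ w (𝓕 g) with hH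
  have hHa : ∀ ξ, H ξ = w ξ * 𝓕 g ξ := fun ξ => by
    rw [hH, smulLeftCLM_apply_apply hw]; simp
  obtain ⟨C₂, hC₂⟩ := exists_norm_schwartz_le (𝓕⁻ H) (d + 1)
  have hsplit : (fun ξ : V => ((‖ξ‖ ^ (2 * σ) : ℝ) : ℂ) * 𝓕 g ξ)
      = fun ξ => m ξ * 𝓕 g ξ + H ξ := by
    funext ξ
    rw [hHa]
    simp only [hm]
    push_cast
    ring
  obtain ⟨K, hK⟩ := exists_norm_schwartz_le (𝓕 g) 0
  have hmg : Integrable fun ξ => m ξ * 𝓕 g ξ := by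
    refine hmi.mul_bdd (c := K) (𝓕 g).continuous.aestronglyMeasurable (.of_forall fun ξ => ?_)
    simpa using hK ξ
  rw [hsplit]
  refine ⟨hmg.add H.integrable, C₁ * (∫ y, (1 + ‖y‖) ^ (d + 1) * ‖g y‖) + C₂, fun x => ?_⟩
  obtain ⟨C₃, hC₃⟩ := exists_norm_schwartz_le g (d + 1 + (d + 1))
  rw [fourierInv_add_of_integrable hmg H.integrable]
  have hgi : Integrable fun y => (1 + ‖y‖) ^ (d + 1) * ‖g y‖ := by
    have h0 := (integrable_one_add_norm (E := V) (μ := volume) (r := d + 1)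
      (by push_cast [hd]; linarith)).const_mul C₃
    refine h0.mono' (by have := g.continuous; fun_prop) (.of_forall fun y => ?_)
    rw [Real.norm_of_nonneg (by positivity), Real.rpow_neg (by positivity)]
    have := hC₃ y
    rw [pow_add, mul_assoc] at this
    rw [← div_eq_mul_inv, le_div_iff₀ (by positivity)]
    calc _ = (1 + ‖y‖) ^ (d + 1) * ((1 + ‖y‖) ^ (d + 1) * ‖g y‖) := by
          rw [← Nat.cast_add_one, Real.rpow_natCast]; ring
      _ ≤ _ := this
  have h2 : (1 + ‖x‖) ^ (d + 1) * ‖𝓕⁻ (H : V → ℂ) x‖ ≤ C₂ := by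
    have := hC₂ x
    rwa [SchwartzMap.fourierInv_coe] at this
  have h1 : (1 + ‖x‖) ^ (d + 1) * ‖𝓕⁻ (fun ξ => m ξ * 𝓕 g ξ) x‖
      ≤ C₁ * ∫ y, (1 + ‖y‖) ^ (d + 1) * ‖g y‖ := by
    have := fourierInv_mul_fourier hmi g.integrable x
    rw [SchwartzMap.fourier_coe, this, ← integral_const_mul, ← abs_of_nonneg
      (show 0 ≤ (1 + ‖x‖) ^ (d + 1) by positivity), ← Real.norm_eq_abs, ← norm_smul,
      ← integral_smul]
    refine norm_integral_le_of_norm_le (hgi.const_mul _) (.of_forall fun y => ?_)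
    rw [norm_smul, norm_mul, Real.norm_of_nonneg (by positivity)]
    have hxy : (1 + ‖x‖) ^ (d + 1) ≤ (1 + ‖x - y‖) ^ (d + 1) * (1 + ‖y‖) ^ (d + 1) := by
      rw [← mul_pow]
      refine pow_le_pow_left₀ (by positivity) ?_ _
      have : ‖x‖ ≤ ‖x - y‖ + ‖y‖ := by simpa using norm_add_le (x - y) y
      nlinarith [norm_nonneg (x - y), norm_nonneg y]
    calc _ ≤ (1 + ‖x - y‖) ^ (d + 1) * (1 + ‖y‖) ^ (d + 1) * (‖g y‖ * ‖𝓕⁻ m (x - y)‖) := by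
          gcongr
      _ = ((1 + ‖x - y‖) ^ (d + 1) * ‖𝓕⁻ m (x - y)‖) * ((1 + ‖y‖) ^ (d + 1) * ‖g y‖) := by ring
      _ ≤ _ := by gcongr; exact hC₁ _
  calc _ ≤ (1 + ‖x‖) ^ (d + 1) * (‖𝓕⁻ (fun ξ => m ξ * 𝓕 g ξ) x‖ + ‖𝓕⁻ (H : V → ℂ) x‖) := by
        gcongr; exact norm_add_le _ _
    _ ≤ _ := by rw [mul_add]; exact add_le_add h1 h2

end FourierDecay

/-! ### The fractional Laplacian of test functions -/

section FracLaplacian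

variable {n : ℕ}

theorem fracLaplacian_const_mul (σ c : ℝ) (φ : EuclideanSpace ℝ (Fin n) → ℝ)
    (x : EuclideanSpace ℝ (Fin n)) :
    fracLaplacian σ (fun y => c * φ y) x = c * fracLaplacian σ φ x := by
  have h : ∀ ξ, 𝓕 (fun y : EuclideanSpace ℝ (Fin n) => ((c * φ y : ℝ) : ℂ)) ξ
      = c * 𝓕 (fun y : EuclideanSpace ℝ (Fin n) => (φ y : ℂ)) ξ := fun ξ => by
    simp only [Real.fourier_eq, ← integral_const_mul, mul_smul_comm, Complex.ofReal_mul]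
  unfold fracLaplacian
  simp only [h, mul_left_comm _ (c : ℂ)]
  rw [fourierInv_const_mul, Complex.re_ofReal_mul]

theorem fracLaplacian_comp_smul (σ : ℝ) {c : ℝ} (hc : 0 < c)
    (φ : EuclideanSpace ℝ (Fin n) → ℝ) (x : EuclideanSpace ℝ (Fin n)) :
    fracLaplacian σ (fun y => φ (c • y)) x = c ^ (2 * σ) * fracLaplacian σ φ (c • x) := by
  unfold fracLaplacian
  set F : EuclideanSpace ℝ (Fin n) → ℂ := fun ξ =>
    (((2 * Real.pi * ‖ξ‖) ^ (2 * σ) : ℝ) : ℂ) *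
      𝓕 (fun y : EuclideanSpace ℝ (Fin n) => (φ y : ℂ)) ξ with hF
  have h : (fun ξ : EuclideanSpace ℝ (Fin n) => (((2 * Real.pi * ‖ξ‖) ^ (2 * σ) : ℝ) : ℂ) *
      𝓕 (fun y : EuclideanSpace ℝ (Fin n) => (φ (c • y) : ℂ)) ξ)
      = fun ξ => ((c ^ (2 * σ) * (c ^ Module.finrank ℝ (EuclideanSpace ℝ (Fin n)))⁻¹ : ℝ) : ℂ)
        * F (c⁻¹ • ξ) := by
    funext ξ
    rw [fourier_comp_smul hc fun y : EuclideanSpace ℝ (Fin n) => (φ y : ℂ)]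
    have : (2 * Real.pi * ‖ξ‖) ^ (2 * σ)
        = c ^ (2 * σ) * (2 * Real.pi * ‖c⁻¹ • ξ‖) ^ (2 * σ) := by
      rw [← Real.mul_rpow hc.le (by positivity), norm_smul, Real.norm_of_nonneg (by positivity)]
      congr 1
      field_simp
    simp only [hF]
    rw [this, Complex.real_smul]
    push_cast
    ring
  rw [h, fourierInv_const_mul, fourierInv_comp_smul (inv_pos.2 hc), Complex.re_ofReal_mul,
    Complex.smul_re, inv_inv, smul_eq_mul, inv_pow, inv_inv]
  field_simp

/-- For `φ ∈ C_c^∞` the symbol of `(-Δ)^σ` times `𝓕 φ` is integrable, and `(-Δ)^σ φ` decays like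
`‖x‖^{-(n+1)}`. -/
theorem exists_decay_fracLaplacian {σ : ℝ} (hσ : 1 ≤ σ) {φ : EuclideanSpace ℝ (Fin n) → ℝ}
    (hφ : ContDiff ℝ ∞ φ) (hφc : HasCompactSupport φ) :
    Integrable (fun ξ : EuclideanSpace ℝ (Fin n) => (((2 * Real.pi * ‖ξ‖) ^ (2 * σ) : ℝ) : ℂ) *
      𝓕 (fun y : EuclideanSpace ℝ (Fin n) => (φ y : ℂ)) ξ) ∧
    ∃ C, 0 ≤ C ∧ ∀ x, |fracLaplacian σ φ x| ≤ C * ((1 + ‖x‖) ^ (n + 1))⁻¹ := by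
  have hs : ContDiff ℝ ∞ fun y => (φ y : ℂ) := Complex.ofRealCLM.contDiff.comp hφ
  have hc : HasCompactSupport fun y => (φ y : ℂ) := hφc.comp_left (g := Complex.ofReal) (by simp)
  obtain ⟨hi, C, hC⟩ :=
    exists_decay_fourierInv_norm_rpow_mul_fourier hσ (hc.toSchwartzMap hs)
  have hF : ∀ ξ, 𝓕 (hc.toSchwartzMap hs) ξ = 𝓕 (fun y => (φ y : ℂ)) ξ := fun ξ => by
    rw [SchwartzMap.fourier_coe]; rfl
  simp only [hF] at hi hC
  have hsplit : (fun ξ : EuclideanSpace ℝ (Fin n) => (((2 * Real.pi * ‖ξ‖) ^ (2 * σ) : ℝ) : ℂ) *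
      𝓕 (fun y : EuclideanSpace ℝ (Fin n) => (φ y : ℂ)) ξ)
      = fun ξ => (((2 * Real.pi) ^ (2 * σ) : ℝ) : ℂ) * ((‖ξ‖ ^ (2 * σ) : ℝ) *
        𝓕 (fun y : EuclideanSpace ℝ (Fin n) => (φ y : ℂ)) ξ) := by
    funext ξ
    rw [Real.mul_rpow (by positivity) (norm_nonneg _)]
    push_cast
    ring
  refine ⟨by rw [hsplit]; exact hi.const_mul _, (2 * Real.pi) ^ (2 * σ) * C, ?_, fun x => ?_⟩
  · have := hC 0
    have : 0 ≤ C := le_trans (by positivity) this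
    positivity
  · unfold fracLaplacian
    rw [hsplit, fourierInv_const_mul]
    refine (Complex.abs_re_le_norm _).trans ?_
    rw [norm_mul, Complex.norm_real, Real.norm_of_nonneg (by positivity), mul_assoc]
    gcongr
    have := hC x
    rw [finrank_euclideanSpace_fin] at this
    rwa [← div_eq_mul_inv, le_div_iff₀' (by positivity)]

theorem fracLaplacian_add {σ : ℝ} (hσ : 1 ≤ σ) {φ ψ : EuclideanSpace ℝ (Fin n) → ℝ}
    (hφ : ContDiff ℝ ∞ φ) (hφc : HasCompactSupport φ) (hψ : ContDiff ℝ ∞ ψ)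
    (hψc : HasCompactSupport ψ) (x : EuclideanSpace ℝ (Fin n)) :
    fracLaplacian σ (fun y => φ y + ψ y) x = fracLaplacian σ φ x + fracLaplacian σ ψ x := by
  have h : ∀ ξ, 𝓕 (fun y : EuclideanSpace ℝ (Fin n) => ((φ y + ψ y : ℝ) : ℂ)) ξ
      = 𝓕 (fun y : EuclideanSpace ℝ (Fin n) => (φ y : ℂ)) ξ
        + 𝓕 (fun y : EuclideanSpace ℝ (Fin n) => (ψ y : ℂ)) ξ := fun ξ => by
    simp only [Real.fourier_eq, smul_add, Complex.ofReal_add]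
    refine integral_add ?_ ?_
    · exact (Real.fourierIntegral_convergent_iff ξ).2
        (hφ.continuous.integrable_of_hasCompactSupport hφc).ofReal
    · exact (Real.fourierIntegral_convergent_iff ξ).2
        (hψ.continuous.integrable_of_hasCompactSupport hψc).ofReal
  unfold fracLaplacian
  simp only [h, mul_add]
  rw [fourierInv_add_of_integrable (exists_decay_fracLaplacian hσ hφ hφc).1
    (exists_decay_fracLaplacian hσ hψ hψc).1, Complex.add_re]

/-- Finite sums of test functions are compactly supported, and `(-Δ)^σ` is additive on them. Both are
proved in one induction, as additivity uses the compact support of the partial sums. -/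
theorem fracLaplacian_sum {σ : ℝ} (hσ : 1 ≤ σ) {φ : ℕ → EuclideanSpace ℝ (Fin n) → ℝ}
    (hφ : ∀ j, ContDiff ℝ ∞ (φ j)) (hφc : ∀ j, HasCompactSupport (φ j)) (N : ℕ) :
    HasCompactSupport (fun y => ∑ j ∈ Finset.range N, φ j y) ∧
    ∀ x, fracLaplacian σ (fun y => ∑ j ∈ Finset.range N, φ j y) x
      = ∑ j ∈ Finset.range N, fracLaplacian σ (φ j) x := by
  induction N with
  | zero =>
    refine ⟨by simpa using! HasCompactSupport.zero, fun x => ?_⟩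
    simpa using fracLaplacian_const_mul σ 0 (fun _ : EuclideanSpace ℝ (Fin n) => 0) x
  | succ N ih =>
    simp only [Finset.sum_range_succ]
    refine ⟨ih.1.add (hφc N), fun x => ?_⟩
    rw [fracLaplacian_add hσ (ContDiff.sum fun j _ => hφ j) ih.1 (hφ N) (hφc N), ih.2]

end FracLaplacian

noncomputable section DyadicProfile

variable {n : ℕ}

/-- The weight `(1 + |x|)^{-(n+1)}`. It is integrable, and decays slowly enough to dominate
`(-Δ)^σ φ` for test functions `φ`. -/
def polyWeight (x : EuclideanSpace ℝ (Fin n)) : ℝ := ((1 + ‖x‖) ^ (n + 1))⁻¹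

theorem polyWeight_pos (x : EuclideanSpace ℝ (Fin n)) : 0 < polyWeight x := by
  unfold polyWeight; positivity

theorem polyWeight_le_one (x : EuclideanSpace ℝ (Fin n)) : polyWeight x ≤ 1 :=
  inv_le_one_of_one_le₀ (one_le_pow₀ (by linarith [norm_nonneg x]))

theorem continuous_polyWeight : Continuous (polyWeight (n := n)) := by
  unfold polyWeight
  exact Continuous.inv₀ (by fun_prop) fun x => by positivity

theorem integrable_polyWeight : Integrable (polyWeight (n := n)) := by
  have h := integrable_one_add_norm (E := EuclideanSpace ℝ (Fin n)) (μ := volume) (r := n + 1)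
    (by rw [finrank_euclideanSpace_fin]; linarith)
  refine h.congr (.of_forall fun x => ?_)
  simp only [polyWeight]
  rw [Real.rpow_neg (by positivity), ← Nat.cast_add_one, Real.rpow_natCast]

/-- The dilates of the weight with the normalization used in `dyadicProfile` are decreasing in `j`. -/
theorem pow_mul_polyWeight_smul (j : ℕ) (x : EuclideanSpace ℝ (Fin n)) :
    (((1 / 2 : ℝ) ^ (n + 1)) ^ j) * polyWeight ((1 / 2 : ℝ) ^ j • x)
      = ((2 ^ j + ‖x‖) ^ (n + 1))⁻¹ := by
  unfold polyWeight
  rw [norm_smul, norm_pow, Real.norm_of_nonneg (by norm_num : (0 : ℝ) ≤ 1 / 2), ← pow_mul,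
    mul_comm (n + 1) j, pow_mul, ← inv_pow, ← mul_pow, ← inv_pow]
  congr 1
  rw [one_div, inv_pow, ← mul_inv]
  congr 1
  field_simp

/-- A smooth bump on `ℝⁿ` that is `1` on the unit ball and is supported in the ball of radius `2`. -/
def unitBump (n : ℕ) : ContDiffBump (0 : EuclideanSpace ℝ (Fin n)) where
  rIn := 1
  rOut := 2
  rIn_pos := one_pos
  rIn_lt_rOut := one_lt_two

/-- The sum `∑_{j<N} 2^{-j(n+1)} b(2^{-j} x)` of dilated bumps: a smooth compactly supported function
that approximates a function comparable to `polyWeight`. -/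
def dyadicProfile (N : ℕ) (x : EuclideanSpace ℝ (Fin n)) : ℝ :=
  ∑ j ∈ Finset.range N, ((1 / 2 : ℝ) ^ (n + 1)) ^ j * unitBump n ((1 / 2 : ℝ) ^ j • x)

theorem contDiff_dyadicProfile (N : ℕ) : ContDiff ℝ ∞ (dyadicProfile (n := n) N) :=
  ContDiff.sum fun j _ => contDiff_const.mul
    ((unitBump n).contDiff.comp (contDiff_const_smul ((1 / 2 : ℝ) ^ j)))

theorem hasCompactSupport_unitBump_smul {c : ℝ} (hc : c ≠ 0) :
    HasCompactSupport fun x => unitBump n (c • x) :=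
  (unitBump n).hasCompactSupport.comp_homeomorph (Homeomorph.smulOfNeZero c hc)

theorem hasCompactSupport_dyadicProfile (N : ℕ) :
    HasCompactSupport (dyadicProfile (n := n) N) :=
  (fracLaplacian_sum le_rfl (φ := fun j x =>
    ((1 / 2 : ℝ) ^ (n + 1)) ^ j * unitBump n ((1 / 2 : ℝ) ^ j • x))
    (fun j => contDiff_const.mul
      ((unitBump n).contDiff.comp (contDiff_const_smul ((1 / 2 : ℝ) ^ j))))
    (fun j => (hasCompactSupport_unitBump_smul (by positivity)).mul_left) N).1

theorem dyadicProfile_nonneg (N : ℕ) (x : EuclideanSpace ℝ (Fin n)) : 0 ≤ dyadicProfile N x :=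
  Finset.sum_nonneg fun _ _ => mul_nonneg (by positivity) (unitBump n).nonneg

theorem dyadicProfile_of_norm_le_one (N : ℕ) {x : EuclideanSpace ℝ (Fin n)} (hx : ‖x‖ ≤ 1) :
    dyadicProfile N x = dyadicProfile N (0 : EuclideanSpace ℝ (Fin n)) := by
  refine Finset.sum_congr rfl fun j _ => ?_
  have h : ∀ y : EuclideanSpace ℝ (Fin n), ‖y‖ ≤ 1 → unitBump n y = 1 := fun y hy =>
    (unitBump n).one_of_mem_closedBall (by simpa [unitBump] using hy)
  rw [h, h _ (by simp)]
  rw [norm_smul, norm_pow, Real.norm_of_nonneg (by norm_num : (0 : ℝ) ≤ 1 / 2)]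
  exact mul_le_one₀ (pow_le_one₀ (by norm_num) (by norm_num)) (norm_nonneg _) hx

theorem one_le_dyadicProfile_zero {N : ℕ} (hN : 1 ≤ N) :
    1 ≤ dyadicProfile N (0 : EuclideanSpace ℝ (Fin n)) := by
  have h := Finset.single_le_sum (s := Finset.range N)
    (f := fun j => ((1 / 2 : ℝ) ^ (n + 1)) ^ j *
      unitBump n ((1 / 2 : ℝ) ^ j • (0 : EuclideanSpace ℝ (Fin n))))
    (fun _ _ => mul_nonneg (by positivity) (unitBump n).nonneg)
    (Finset.mem_range.2 (Nat.lt_of_lt_of_le one_pos hN))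
  have h0 : unitBump n (0 : EuclideanSpace ℝ (Fin n)) = 1 :=
    (unitBump n).one_of_mem_closedBall (by simp [unitBump])
  refine le_trans ?_ h
  simp [h0]

/-- Upper bound by the weight, from the recursion `Φ_{N+1}(x) = b(x) + 2^{-(n+1)} Φ_N(x/2)`. -/
theorem dyadicProfile_le (N : ℕ) (x : EuclideanSpace ℝ (Fin n)) :
    dyadicProfile N x ≤ 12 ^ (n + 1) * polyWeight x := by
  induction N generalizing x with
  | zero => simpa [dyadicProfile] using (polyWeight_pos x).le
  | succ N ih =>
    have hrec : dyadicProfile (N + 1) x = unitBump n x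
        + (1 / 2 : ℝ) ^ (n + 1) * dyadicProfile N ((1 / 2 : ℝ) • x) := by
      unfold dyadicProfile
      rw [Finset.sum_range_succ', Finset.mul_sum, add_comm]
      simp only [pow_zero, one_mul, one_smul, smul_smul]
      refine congrArg _ (Finset.sum_congr rfl fun j _ => ?_)
      rw [← pow_succ, ← mul_assoc, pow_succ' (_ : ℝ) j]
    have h1 := pow_mul_polyWeight_smul 1 x
    simp only [pow_one] at h1
    have h2 : (1 / 2 : ℝ) ^ (n + 1) * dyadicProfile N ((1 / 2 : ℝ) • x)
        ≤ 12 ^ (n + 1) * ((2 + ‖x‖) ^ (n + 1))⁻¹ := by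
      rw [← h1, mul_left_comm]
      gcongr
      exact ih _
    have h3 : ((2 + ‖x‖) ^ (n + 1))⁻¹ ≤ polyWeight x := by
      unfold polyWeight
      gcongr
      norm_num
    rw [hrec]
    rcases le_or_gt 2 ‖x‖ with hx | hx
    · rw [(unitBump n).zero_of_le_dist (by simpa [unitBump] using hx), zero_add]
      exact h2.trans (by gcongr)
    -- on the support of the bump the gain from `(1 + |x|)^{-(n+1)}` to `(2 + |x|)^{-(n+1)}` pays for
    -- `b ≤ 1`; this is where the constant `12 = 3 * 4` comes from
    · have h4 : ((1 + ‖x‖) ^ (n + 1)) + 1 ≤ (2 + ‖x‖) ^ (n + 1) := by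
        have h := pow_add_pow_le (x := 1 + ‖x‖) (y := 1) (by positivity) zero_le_one
          (Nat.succ_ne_zero n)
        rw [one_pow] at h
        exact h.trans_eq (by rw [Nat.succ_eq_add_one]; ring)
      have h5 : (1 + ‖x‖) ^ (n + 1) * (2 + ‖x‖) ^ (n + 1) ≤ 12 ^ (n + 1) := by
        rw [← mul_pow]
        exact pow_le_pow_left₀ (by positivity) (by nlinarith [norm_nonneg x]) _
      have h6 : 1 ≤ 12 ^ (n + 1) * (polyWeight x - ((2 + ‖x‖) ^ (n + 1))⁻¹) := by
        unfold polyWeight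
        rw [inv_sub_inv (by positivity) (by positivity), mul_div_assoc', le_div_iff₀
          (by positivity), one_mul]
        refine h5.trans (le_mul_of_one_le_right (by positivity) (by linarith))
      linarith [(unitBump n).le_one (x := x)]

/-- For each `x` a single summand, that of the scale `2^j ≈ 1 + |x|`, already gives the lower bound
by the weight. -/
theorem exists_le_dyadicProfile (x : EuclideanSpace ℝ (Fin n)) :
    ∃ N₀, ∀ N, N₀ ≤ N → (1 / 2) ^ (n + 1) * polyWeight x ≤ dyadicProfile N x := by
  obtain ⟨j, hj1, hj2⟩ := exists_nat_pow_near (x := 1 + ‖x‖) (y := 2)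
    (by linarith [norm_nonneg x]) one_lt_two
  refine ⟨j + 2, fun N hN => ?_⟩
  have h := Finset.single_le_sum (s := Finset.range N)
    (f := fun j => ((1 / 2 : ℝ) ^ (n + 1)) ^ j * unitBump n ((1 / 2 : ℝ) ^ j • x))
    (fun _ _ => mul_nonneg (by positivity) (unitBump n).nonneg)
    (Finset.mem_range.2 (show j + 1 < N by omega))
  refine le_trans ?_ h
  have hb : unitBump n ((1 / 2 : ℝ) ^ (j + 1) • x) = 1 := by
    refine (unitBump n).one_of_mem_closedBall ?_
    simp only [unitBump, mem_closedBall_iff_norm, sub_zero]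
    rw [norm_smul, norm_pow, Real.norm_of_nonneg (by norm_num : (0 : ℝ) ≤ 1 / 2), one_div, inv_pow,
      inv_mul_le_iff₀ (by positivity)]
    linarith
  simp only [hb, mul_one]
  unfold polyWeight
  rw [pow_succ (_ : ℝ) j, mul_comm, ← pow_mul, mul_comm (n + 1) j, pow_mul]
  rw [← inv_pow, ← mul_pow, one_div, ← mul_pow, inv_pow 2 j]
  gcongr

/-- The fractional Laplacian of the dyadic sums is bounded by the weight, uniformly in `N`: the dilation
by `2^j` gains a factor `2^{-2σj}`, which makes the bounds of the summands a geometric series. -/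
theorem exists_abs_fracLaplacian_dyadicProfile_le {σ : ℝ} (hσ : 1 ≤ σ) :
    ∃ C, 0 ≤ C ∧ ∀ N, ∀ x : EuclideanSpace ℝ (Fin n),
      |fracLaplacian σ (dyadicProfile N) x| ≤ C * polyWeight x := by
  obtain ⟨-, C, hC0, hC⟩ := exists_decay_fracLaplacian (n := n) hσ (unitBump n).contDiff
    (unitBump n).hasCompactSupport
  refine ⟨2 * C, by positivity, fun N x => ?_⟩
  unfold dyadicProfile
  rw [(fracLaplacian_sum hσ (φ := fun j x =>
    ((1 / 2 : ℝ) ^ (n + 1)) ^ j * unitBump n ((1 / 2 : ℝ) ^ j • x))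
    (fun j => contDiff_const.mul
      ((unitBump n).contDiff.comp (contDiff_const_smul ((1 / 2 : ℝ) ^ j))))
    (fun j => (hasCompactSupport_unitBump_smul (by positivity)).mul_left) N).2]
  have hterm : ∀ j ∈ Finset.range N, |fracLaplacian σ (fun x =>
      ((1 / 2 : ℝ) ^ (n + 1)) ^ j * unitBump n ((1 / 2 : ℝ) ^ j • x)) x|
      ≤ (1 / 2 : ℝ) ^ j * (C * polyWeight x) := by
    intro j _
    rw [fracLaplacian_const_mul, fracLaplacian_comp_smul σ (by positivity), abs_mul, abs_mul,
      abs_of_nonneg (by positivity), abs_of_nonneg (by positivity)]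
    have h1 : ((1 / 2 : ℝ) ^ j) ^ (2 * σ) ≤ (1 / 2 : ℝ) ^ j := by
      have := Real.rpow_le_rpow_of_exponent_ge (x := (1 / 2 : ℝ) ^ j) (by positivity)
        (pow_le_one₀ (by norm_num) (by norm_num)) (show 1 ≤ 2 * σ by linarith)
      simpa using this
    have h2 : ((2 ^ j + ‖x‖) ^ (n + 1))⁻¹ ≤ polyWeight x := by
      unfold polyWeight
      gcongr
      exact one_le_pow₀ one_le_two
    have h3 := hC ((1 / 2 : ℝ) ^ j • x)
    change _ ≤ C * polyWeight _ at h3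
    calc _ ≤ ((1 / 2 : ℝ) ^ (n + 1)) ^ j * ((1 / 2 : ℝ) ^ j *
          (C * polyWeight ((1 / 2 : ℝ) ^ j • x))) := by gcongr
      _ = (1 / 2 : ℝ) ^ j * (C * ((2 ^ j + ‖x‖) ^ (n + 1))⁻¹) := by
        rw [← pow_mul_polyWeight_smul]; ring
      _ ≤ _ := by gcongr
  calc _ ≤ ∑ j ∈ Finset.range N, (1 / 2 : ℝ) ^ j * (C * polyWeight x) :=
        (Finset.abs_sum_le_sum_abs _ _).trans (Finset.sum_le_sum hterm)
    _ ≤ 2 * (C * polyWeight x) := by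
      rw [← Finset.sum_mul]
      have := polyWeight_pos x
      gcongr
      simpa using sum_geometric_two_le N
    _ = _ := by ring

end DyadicProfile

/-! ### Test functions in space-time -/

noncomputable section TestFunctions

variable {n : ℕ}

/-- A smooth bump on `ℝ` that is `1` on `[-1, 1]` and is supported in `[-2, 2]`. -/
def timeBump : ContDiffBump (0 : ℝ) where
  rIn := 1
  rOut := 2
  rIn_pos := one_pos
  rIn_lt_rOut := one_lt_two

/-- Two derivatives of `β^{k+2}` cost at most two powers of `β`. -/
theorem exists_timeBump_pow_deriv_le (k : ℕ) :
    ∃ K, 0 ≤ K ∧ ∀ s, |deriv (fun s => timeBump s ^ (k + 2)) s| ≤ K * timeBump s ^ k ∧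
      |iteratedDeriv 2 (fun s => timeBump s ^ (k + 2)) s| ≤ K * timeBump s ^ k := by
  have hs : ContDiff ℝ ∞ timeBump := timeBump.contDiff
  have hs1 : ContDiff ℝ ∞ (deriv timeBump) := hs.iterate_deriv 1
  obtain ⟨A, hA⟩ := timeBump.hasCompactSupport.deriv.exists_bound_of_continuous hs1.continuous
  obtain ⟨B, hB⟩ := timeBump.hasCompactSupport.deriv.deriv.exists_bound_of_continuous
    (hs1.continuous_deriv (by simp))
  simp only [Real.norm_eq_abs] at hA hB
  have hA0 : 0 ≤ A := (abs_nonneg _).trans (hA 0)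
  have hB0 : 0 ≤ B := (abs_nonneg _).trans (hB 0)
  have hd : ∀ s, HasDerivAt timeBump (deriv timeBump s) s := fun s =>
    (hs.differentiable (by simp) s).hasDerivAt
  have hd1 : ∀ s, HasDerivAt (deriv timeBump) (deriv (deriv timeBump) s) s := fun s =>
    (hs1.differentiable (by simp) s).hasDerivAt
  have h1 : deriv (fun s => timeBump s ^ (k + 2))
      = fun s => (k + 2) * (timeBump s ^ (k + 1) * deriv timeBump s) := by
    funext s
    rw [((hd s).fun_pow (k + 2)).deriv]
    push_cast
    ring
  have h2 : iteratedDeriv 2 (fun s => timeBump s ^ (k + 2))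
      = fun s => (k + 2) * ((k + 1) * timeBump s ^ k * deriv timeBump s * deriv timeBump s
        + timeBump s ^ (k + 1) * deriv (deriv timeBump) s) := by
    funext s
    rw [iteratedDeriv_succ, iteratedDeriv_one, h1]
    have := (((hd s).fun_pow (k + 1)).fun_mul (hd1 s)).const_mul ((k : ℝ) + 2)
    rw [this.deriv]
    push_cast
    simp
  have hb : ∀ s, timeBump s ^ (k + 1) ≤ timeBump s ^ k := fun s =>
    pow_le_pow_of_le_one timeBump.nonneg timeBump.le_one (Nat.le_succ k)
  have hb0 : ∀ s (j : ℕ), 0 ≤ timeBump s ^ j := fun s j => pow_nonneg timeBump.nonneg j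
  refine ⟨(k + 2) * A + (k + 2) * ((k + 1) * A * A + B), by positivity, fun s => ⟨?_, ?_⟩⟩
  · rw [h1, abs_mul, abs_mul, abs_of_nonneg (hb0 s _), abs_of_nonneg (by positivity)]
    have h3 : timeBump s ^ (k + 1) * |deriv timeBump s| ≤ timeBump s ^ k * A :=
      mul_le_mul (hb s) (hA s) (abs_nonneg _) (hb0 s _)
    have h4 : 0 ≤ (k + 2) * ((k + 1) * A * A + B) * timeBump s ^ k :=
      mul_nonneg (by positivity) (hb0 s _)
    calc _ ≤ ((k : ℝ) + 2) * (timeBump s ^ k * A) := by gcongr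
      _ = (k + 2) * A * timeBump s ^ k := by ring
      _ ≤ _ := by linarith
  · rw [h2]
    have h3 : |(k + 1) * timeBump s ^ k * deriv timeBump s * deriv timeBump s
        + timeBump s ^ (k + 1) * deriv (deriv timeBump) s|
        ≤ ((k + 1) * A * A + B) * timeBump s ^ k := by
      refine (abs_add_le _ _).trans ?_
      refine (add_le_add (b := (k + 1) * A * A * timeBump s ^ k) (d := B * timeBump s ^ k)
        ?_ ?_).trans_eq (by ring)
      · rw [abs_mul, abs_mul, abs_mul, abs_of_nonneg (hb0 s _), abs_of_nonneg (by positivity :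
            (0 : ℝ) ≤ (k : ℝ) + 1)]
        have h5 : |deriv timeBump s| * |deriv timeBump s| ≤ A * A :=
          mul_le_mul (hA s) (hA s) (abs_nonneg _) hA0
        have h6 := mul_le_mul_of_nonneg_left h5
          (mul_nonneg (by positivity : (0 : ℝ) ≤ (k : ℝ) + 1) (hb0 s k))
        linarith
      · rw [abs_mul, abs_of_nonneg (hb0 s _), mul_comm B]
        exact mul_le_mul (hb s) (hB s) (abs_nonneg _) (hb0 s _)
    rw [abs_mul, abs_of_nonneg (by positivity)]
    have h4 : 0 ≤ (k + 2) * A * timeBump s ^ k := mul_nonneg (by positivity) (hb0 s _)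
    calc _ ≤ ((k : ℝ) + 2) * (((k + 1) * A * A + B) * timeBump s ^ k) := by gcongr
      _ = (k + 2) * ((k + 1) * A * A + B) * timeBump s ^ k := by ring
      _ ≤ _ := by linarith

/-- The weight `β(t/T)^k W(x/R)` with `β = timeBump` and `W = polyWeight`. -/
def spacetimeWeight (k : ℕ) (T R : ℝ) (z : ℝ × EuclideanSpace ℝ (Fin n)) : ℝ :=
  timeBump (T⁻¹ * z.1) ^ k * polyWeight (R⁻¹ • z.2)

/-- The test function `β(t/T)^{k+2} Φ_N(x/R)` with `β = timeBump` and `Φ_N = dyadicProfile N`. -/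
def testFunction (k N : ℕ) (T R : ℝ) (t : ℝ) (x : EuclideanSpace ℝ (Fin n)) : ℝ :=
  timeBump (T⁻¹ * t) ^ (k + 2) * dyadicProfile N (R⁻¹ • x)

theorem contDiff_testFunction (k N : ℕ) (T R : ℝ) :
    ContDiff ℝ ∞ (Function.uncurry (testFunction (n := n) k N T R)) := by
  refine ContDiff.mul (ContDiff.pow ?_ _) ?_
  · exact (timeBump.contDiff (n := ⊤)).comp (contDiff_const.mul contDiff_fst)
  · exact (contDiff_dyadicProfile N).comp (contDiff_snd.const_smul R⁻¹)

theorem hasCompactSupport_testFunction (k N : ℕ) {T R : ℝ} (hT : 0 < T) (hR : 0 < R) :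
    HasCompactSupport (Function.uncurry (testFunction (n := n) k N T R)) := by
  have h1 : HasCompactSupport fun t : ℝ => timeBump (T⁻¹ * t) ^ (k + 2) :=
    (timeBump.hasCompactSupport.comp_homeomorph
      (Homeomorph.mulLeft₀ T⁻¹ (by positivity))).comp_left (g := fun y : ℝ => y ^ (k + 2))
      (by simp)
  have h2 : HasCompactSupport fun x : EuclideanSpace ℝ (Fin n) => dyadicProfile N (R⁻¹ • x) :=
    (hasCompactSupport_dyadicProfile N).comp_homeomorph
      (Homeomorph.smulOfNeZero R⁻¹ (by positivity))
  refine HasCompactSupport.of_support_subset_isCompact (h1.isCompact.prod h2.isCompact) ?_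
  rintro ⟨t, x⟩ hz
  have := mul_ne_zero_iff.1 (Function.mem_support.1 hz)
  exact ⟨subset_tsupport _ this.1, subset_tsupport _ this.2⟩

theorem testFunction_nonneg (k N : ℕ) (T R t : ℝ) (x : EuclideanSpace ℝ (Fin n)) :
    0 ≤ testFunction k N T R t x :=
  mul_nonneg (pow_nonneg timeBump.nonneg _) (dyadicProfile_nonneg _ _)

theorem timeBump_zero : timeBump 0 = 1 :=
  timeBump.one_of_mem_closedBall (by simp [timeBump])

theorem testFunction_zero (k N : ℕ) (T R : ℝ) (x : EuclideanSpace ℝ (Fin n)) :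
    testFunction k N T R 0 x = dyadicProfile N (R⁻¹ • x) := by
  simp [testFunction, timeBump_zero]

theorem deriv_testFunction (k N : ℕ) (T R t : ℝ) (x : EuclideanSpace ℝ (Fin n)) :
    deriv (fun s => testFunction k N T R s x) t
      = T⁻¹ * deriv (fun s => timeBump s ^ (k + 2)) (T⁻¹ * t) * dyadicProfile N (R⁻¹ • x) := by
  unfold testFunction
  rw [deriv_mul_const_field, deriv_comp_mul_left (f := fun s => timeBump s ^ (k + 2)),
    smul_eq_mul]

theorem iteratedDeriv_two_testFunction (k N : ℕ) (T R t : ℝ) (x : EuclideanSpace ℝ (Fin n)) :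
    iteratedDeriv 2 (fun s => testFunction k N T R s x) t
      = T⁻¹ ^ 2 * iteratedDeriv 2 (fun s => timeBump s ^ (k + 2)) (T⁻¹ * t)
        * dyadicProfile N (R⁻¹ • x) := by
  unfold testFunction
  rw [iteratedDeriv_mul_const_field,
    iteratedDeriv_comp_const_mul (f := fun s => timeBump s ^ (k + 2)) (timeBump.contDiff.pow _)]

theorem deriv_testFunction_zero (k N : ℕ) (T R : ℝ) (x : EuclideanSpace ℝ (Fin n)) :
    deriv (fun s => testFunction k N T R s x) 0 = 0 := by
  have h : (fun s => timeBump s ^ (k + 2)) =ᶠ[nhds 0] fun _ => 1 := by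
    filter_upwards [timeBump.eventuallyEq_one] with s hs
    simp only [Pi.one_apply] at hs
    simp [hs]
  rw [deriv_testFunction, mul_zero, h.deriv_eq]
  simp

/-- With `T = R^{2σ}`, `R ≥ 1`, the adjoint operator applied to the test function is at most
`R^{-2σ}` times the weight, uniformly in `N`. -/
theorem exists_abs_dual_testFunction_le {σ : ℝ} (hσ : 1 ≤ σ) (k : ℕ) :
    ∃ K, 0 ≤ K ∧ ∀ N, ∀ R : ℝ, 1 ≤ R → ∀ t, ∀ x : EuclideanSpace ℝ (Fin n),
      |iteratedDeriv 2 (fun s => testFunction k N (R ^ (2 * σ)) R s x) t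
        + fracLaplacian σ (testFunction k N (R ^ (2 * σ)) R t) x
        - deriv (fun s => testFunction k N (R ^ (2 * σ)) R s x) t
        - fracLaplacian σ (fun y => deriv (fun s => testFunction k N (R ^ (2 * σ)) R s y) t) x|
      ≤ K * (R ^ (2 * σ))⁻¹ * spacetimeWeight k (R ^ (2 * σ)) R (t, x) := by
  obtain ⟨A, hA0, hA⟩ := exists_timeBump_pow_deriv_le k
  obtain ⟨C, hC0, hC⟩ := exists_abs_fracLaplacian_dyadicProfile_le (n := n) hσ
  refine ⟨A * 12 ^ (n + 1) + C + A * 12 ^ (n + 1) + A * C, by positivity,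
    fun N R hR t x => ?_⟩
  have hR0 : 0 < R := by linarith
  have hT1 : 1 ≤ R ^ (2 * σ) := Real.one_le_rpow hR (by linarith)
  set T := R ^ (2 * σ) with hT
  have hTi : T⁻¹ ≤ 1 := inv_le_one_of_one_le₀ hT1
  have hTp : 0 < T⁻¹ := by positivity
  have hscale : R⁻¹ ^ (2 * σ) = T⁻¹ := Real.inv_rpow hR0.le _
  have h1 : fracLaplacian σ (testFunction (n := n) k N T R t) x
      = timeBump (T⁻¹ * t) ^ (k + 2)
        * (T⁻¹ * fracLaplacian σ (dyadicProfile N) (R⁻¹ • x)) := by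
    refine (fracLaplacian_const_mul σ _ (fun y => dyadicProfile N (R⁻¹ • y)) x).trans ?_
    rw [fracLaplacian_comp_smul σ (inv_pos.2 hR0), hscale]
  have h2 : fracLaplacian σ (fun y : EuclideanSpace ℝ (Fin n) =>
        deriv (fun s => testFunction k N T R s y) t) x
      = T⁻¹ * deriv (fun s => timeBump s ^ (k + 2)) (T⁻¹ * t)
        * (T⁻¹ * fracLaplacian σ (dyadicProfile N) (R⁻¹ • x)) := by
    simp only [deriv_testFunction]
    refine (fracLaplacian_const_mul σ _ (fun y => dyadicProfile N (R⁻¹ • y)) x).trans ?_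
    rw [fracLaplacian_comp_smul σ (inv_pos.2 hR0), hscale]
  rw [h1, h2, deriv_testFunction, iteratedDeriv_two_testFunction]
  obtain ⟨hd1, hd2⟩ := hA (T⁻¹ * t)
  have hL := hC N (R⁻¹ • x)
  have hΦ : |dyadicProfile N (R⁻¹ • x)| ≤ 12 ^ (n + 1) * polyWeight (R⁻¹ • x) := by
    rw [abs_of_nonneg (dyadicProfile_nonneg _ _)]
    exact dyadicProfile_le _ _
  have hη : |timeBump (T⁻¹ * t) ^ (k + 2)| ≤ timeBump (T⁻¹ * t) ^ k := by
    rw [abs_of_nonneg (pow_nonneg timeBump.nonneg _)]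
    exact pow_le_pow_of_le_one timeBump.nonneg timeBump.le_one (by omega)
  have hβ : 0 ≤ timeBump (T⁻¹ * t) ^ k := pow_nonneg timeBump.nonneg _
  have hW := (polyWeight_pos (R⁻¹ • x)).le
  unfold spacetimeWeight
  simp only
  set η₀ := timeBump (T⁻¹ * t) ^ (k + 2)
  set η₁ := deriv (fun s => timeBump s ^ (k + 2)) (T⁻¹ * t)
  set η₂ := iteratedDeriv 2 (fun s => timeBump s ^ (k + 2)) (T⁻¹ * t)
  set Φ := dyadicProfile N (R⁻¹ • x)
  set Λ := fracLaplacian σ (dyadicProfile N) (R⁻¹ • x)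
  set W := polyWeight (R⁻¹ • x)
  set β := timeBump (T⁻¹ * t) ^ k
  have e1 : |η₂ * Φ| ≤ A * β * (12 ^ (n + 1) * W) := by
    rw [abs_mul]; exact mul_le_mul hd2 hΦ (abs_nonneg _) (by positivity)
  have e2 : |η₀ * Λ| ≤ β * (C * W) := by
    rw [abs_mul]; exact mul_le_mul hη hL (abs_nonneg _) (by positivity)
  have e3 : |η₁ * Φ| ≤ A * β * (12 ^ (n + 1) * W) := by
    rw [abs_mul]; exact mul_le_mul hd1 hΦ (abs_nonneg _) (by positivity)
  have e4 : |η₁ * Λ| ≤ A * β * (C * W) := by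
    rw [abs_mul]; exact mul_le_mul hd1 hL (abs_nonneg _) (by positivity)
  have key : T⁻¹ ^ 2 * η₂ * Φ + η₀ * (T⁻¹ * Λ) - T⁻¹ * η₁ * Φ - T⁻¹ * η₁ * (T⁻¹ * Λ)
      = T⁻¹ * (T⁻¹ * (η₂ * Φ) + η₀ * Λ - η₁ * Φ - T⁻¹ * (η₁ * Λ)) := by ring
  rw [key, abs_mul, abs_of_pos hTp]
  have hsmall : ∀ a b : ℝ, |a| ≤ b → |T⁻¹ * a| ≤ b := fun a b h => by
    rw [abs_mul, abs_of_pos hTp]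
    exact (mul_le_of_le_one_left (abs_nonneg _) hTi).trans h
  have := hsmall _ _ e1
  have := hsmall _ _ e4
  calc _ ≤ T⁻¹ * (A * β * (12 ^ (n + 1) * W) + β * (C * W) + A * β * (12 ^ (n + 1) * W)
        + A * β * (C * W)) := by
        gcongr
        refine (abs_sub _ _).trans (add_le_add ((abs_sub _ _).trans
          (add_le_add ((abs_add_le _ _).trans (add_le_add ?_ e2)) e3)) ?_) <;> assumption
    _ = _ := by ring

/-- The data terms stay bounded below for large `R`, uniformly in `N`: `Φ_N(x/R)` is the constant
`Φ_N(0) ≥ 1` for `|x| ≤ R`, and the rest of the integral is a tail of `∫ |h|`. -/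
theorem eventually_half_integral_le_integral_mul_dyadicProfile {h : EuclideanSpace ℝ (Fin n) → ℝ}
    (hi : Integrable h) (hpos : 0 < ∫ x, h x) :
    ∀ᶠ R : ℝ in Filter.atTop, ∀ N, 1 ≤ N →
      (∫ x, h x) / 2 ≤ ∫ x, h x * dyadicProfile N (R⁻¹ • x) := by
  have htail : Filter.Tendsto (fun R : ℝ => ∫ x, {x | R < ‖x‖}.indicator (fun x => |h x|) x)
      Filter.atTop (nhds (∫ x : EuclideanSpace ℝ (Fin n), (0 : ℝ))) := by
    refine tendsto_integral_filter_of_dominated_convergence (fun x => |h x|)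
      (.of_forall fun R => ?_) (.of_forall fun R => .of_forall fun x => ?_) hi.abs
      (.of_forall fun x => ?_)
    · exact hi.abs.aestronglyMeasurable.indicator
        (measurableSet_lt measurable_const measurable_norm)
    · exact (norm_indicator_le_norm_self _ _).trans (by simp)
    · refine tendsto_const_nhds.congr' ?_
      filter_upwards [Filter.eventually_ge_atTop ‖x‖] with R hR
      simp [hR]
  rw [integral_zero] at htail
  have hev := (htail.const_mul (12 ^ (n + 1) : ℝ)).eventually_le_const
    (show 12 ^ (n + 1) * (0 : ℝ) < (∫ x, h x) / 2 by rw [mul_zero]; linarith)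
  filter_upwards [hev, Filter.eventually_gt_atTop 0] with R ht hRp N hN
  set S := dyadicProfile N (0 : EuclideanSpace ℝ (Fin n)) with hS
  have hS1 : 1 ≤ S := one_le_dyadicProfile_zero hN
  have hb : ∀ x : EuclideanSpace ℝ (Fin n), dyadicProfile N x ≤ 12 ^ (n + 1) := fun x =>
    (dyadicProfile_le N x).trans (mul_le_of_le_one_right (by positivity) (polyWeight_le_one x))
  have hhi : Integrable fun x => h x * dyadicProfile N (R⁻¹ • x) := by
    refine hi.mul_bdd (c := 12 ^ (n + 1)) ?_ (.of_forall fun x => ?_)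
    · exact ((contDiff_dyadicProfile N).continuous.comp
        (continuous_const_smul R⁻¹)).aestronglyMeasurable
    · rw [Real.norm_of_nonneg (dyadicProfile_nonneg _ _)]
      exact hb _
  have hdiff : |∫ x, (h x * dyadicProfile N (R⁻¹ • x) - S * h x)|
      ≤ ∫ x, 12 ^ (n + 1) * {x | R < ‖x‖}.indicator (fun x => |h x|) x := by
    rw [← Real.norm_eq_abs]
    refine norm_integral_le_of_norm_le ((hi.abs.indicator
      (measurableSet_lt measurable_const measurable_norm)).const_mul _) (.of_forall fun x => ?_)
    rcases le_or_gt ‖x‖ R with hx | hx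
    · have : ‖R⁻¹ • x‖ ≤ 1 := by
        rw [norm_smul, Real.norm_of_nonneg (by positivity), inv_mul_le_iff₀ hRp]
        linarith
      rw [dyadicProfile_of_norm_le_one N this, ← hS, mul_comm, sub_self]
      simp [hx]
    · rw [indicator_of_mem (show x ∈ {x | R < ‖x‖} from hx), mul_comm S, ← mul_sub,
        Real.norm_eq_abs, abs_mul, mul_comm]
      gcongr
      rw [abs_le]
      constructor <;> linarith [hb (R⁻¹ • x), hb 0, dyadicProfile_nonneg N (R⁻¹ • x)]
  rw [integral_sub hhi (hi.const_mul _), integral_const_mul, integral_const_mul] at hdiff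
  have := (abs_le.1 hdiff).1
  nlinarith

end TestFunctions

/-! ### Weighted space-time integrals -/

noncomputable section WeightedIntegrals

open Filter

variable {n : ℕ}

/-- Lebesgue measure on `[0, ∞) × ℝⁿ`, as a measure on `ℝ × ℝⁿ`. -/
def spacetimeMeasure (n : ℕ) : Measure (ℝ × EuclideanSpace ℝ (Fin n)) :=
  (volume.restrict (Ici (0 : ℝ))).prod volume

theorem volume_restrict_eq_spacetimeMeasure :
    (volume : Measure (ℝ × EuclideanSpace ℝ (Fin n))).restrict (Ici (0 : ℝ) ×ˢ univ)
      = spacetimeMeasure n := by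
  rw [spacetimeMeasure, Measure.volume_eq_prod, ← Measure.prod_restrict, Measure.restrict_univ]

theorem continuous_spacetimeWeight (k : ℕ) (T R : ℝ) :
    Continuous (spacetimeWeight (n := n) k T R) := by
  have h1 : Continuous timeBump := timeBump.continuous
  have h2 := continuous_polyWeight (n := n)
  unfold spacetimeWeight
  fun_prop

theorem spacetimeWeight_nonneg (k : ℕ) (T R : ℝ) (z : ℝ × EuclideanSpace ℝ (Fin n)) :
    0 ≤ spacetimeWeight k T R z :=
  mul_nonneg (pow_nonneg timeBump.nonneg _) (polyWeight_pos _).le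

theorem integrable_mul_testFunction {g : ℝ → EuclideanSpace ℝ (Fin n) → ℝ}
    (hg : LocallyIntegrableOn (fun z : ℝ × EuclideanSpace ℝ (Fin n) => g z.1 z.2)
      (Ici (0 : ℝ) ×ˢ univ)) (k N : ℕ) {T R : ℝ} (hT : 0 < T) (hR : 0 < R) :
    Integrable (fun z => g z.1 z.2 * testFunction k N T R z.1 z.2) (spacetimeMeasure n) := by
  have hc := hasCompactSupport_testFunction (n := n) k N hT hR
  have hcont := (contDiff_testFunction (n := n) k N T R).continuous
  obtain ⟨B, hB⟩ := hc.exists_bound_of_continuous hcont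
  rw [← volume_restrict_eq_spacetimeMeasure]
  have hclosed : IsClosed (Ici (0 : ℝ) ×ˢ (univ : Set (EuclideanSpace ℝ (Fin n)))) :=
    isClosed_Ici.prod isClosed_univ
  have hK : IsCompact (tsupport (Function.uncurry (testFunction (n := n) k N T R))
      ∩ (Ici (0 : ℝ) ×ˢ univ)) := hc.isCompact.inter_right hclosed
  have hi : IntegrableOn (fun z => g z.1 z.2 * testFunction k N T R z.1 z.2)
      (tsupport (Function.uncurry (testFunction (n := n) k N T R)) ∩ (Ici (0 : ℝ) ×ˢ univ)) :=
    (hg.integrableOn_compact_subset inter_subset_right hK).mul_bdd (c := B)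
      hcont.aestronglyMeasurable (.of_forall hB)
  refine hi.of_forall_sdiff_eq_zero hclosed.measurableSet fun z hz => ?_
  have : z ∉ tsupport (Function.uncurry (testFunction (n := n) k N T R)) := fun h =>
    hz.2 ⟨h, hz.1⟩
  have h0 : testFunction k N T R z.1 z.2 = 0 :=
    image_eq_zero_of_notMem_tsupport (f := Function.uncurry (testFunction k N T R)) this
  simp [h0]

/-- The inequality obtained by testing the equation with `testFunction` and letting `N → ∞`. Fatou's
lemma suffices, since only the weighted integral of the source term depends on `N` after the
estimate of the adjoint term; the integrals are taken in `[0, ∞]`, so no integrability of the source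
term against the non-compact weight is needed beforehand. -/
theorem IsWeakCauchySolution.exists_weighted_le {σ : ℝ} (hσ : 1 ≤ σ) (k : ℕ)
    {g u : ℝ → EuclideanSpace ℝ (Fin n) → ℝ} {v₀ v₁ f₀ : EuclideanSpace ℝ (Fin n) → ℝ}
    (hsol : IsWeakCauchySolution σ g u v₀ v₁) (hg0 : ∀ t x, 0 ≤ g t x)
    (hg : LocallyIntegrableOn (fun z : ℝ × EuclideanSpace ℝ (Fin n) => g z.1 z.2)
      (Ici (0 : ℝ) ×ˢ univ))
    (hu : AEStronglyMeasurable (Function.uncurry u) (spacetimeMeasure n))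
    (hf : IsDistribHelmholtz σ v₀ f₀) (hfi : Integrable f₀) (hvi : Integrable v₁)
    (hfpos : 0 < ∫ x, f₀ x) (hvpos : 0 < ∫ x, v₁ x) :
    ∃ K δ : ℝ, 0 ≤ K ∧ 0 < δ ∧ ∀ᶠ R : ℝ in atTop,
      ENNReal.ofReal ((1 / 2) ^ (n + 1)) * (∫⁻ z, ENNReal.ofReal
          (g z.1 z.2 * spacetimeWeight (k + 2) (R ^ (2 * σ)) R z) ∂spacetimeMeasure n)
        + ENNReal.ofReal δ
      ≤ ENNReal.ofReal (K * (R ^ (2 * σ))⁻¹) * ∫⁻ z, ENNReal.ofReal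
          (|u z.1 z.2| * spacetimeWeight k (R ^ (2 * σ)) R z) ∂spacetimeMeasure n := by
  obtain ⟨K, hK0, hK⟩ := exists_abs_dual_testFunction_le (n := n) hσ k
  refine ⟨K, (∫ x, v₁ x) / 2 + (∫ x, f₀ x) / 2, hK0, by positivity, ?_⟩
  filter_upwards [eventually_half_integral_le_integral_mul_dyadicProfile hvi hvpos,
    eventually_half_integral_le_integral_mul_dyadicProfile hfi hfpos,
    eventually_ge_atTop 1] with R hRv hRf hR1
  have hR0 : 0 < R := by linarith
  set T := R ^ (2 * σ) with hT
  have hT0 : 0 < T := by positivity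
  set δ := (∫ x, v₁ x) / 2 + (∫ x, f₀ x) / 2 with hδ
  set X := ENNReal.ofReal (K * T⁻¹) * ∫⁻ z, ENNReal.ofReal
          (|u z.1 z.2| * spacetimeWeight k T R z) ∂spacetimeMeasure n with hX
  have hXN : ∀ N, 1 ≤ N → (∫⁻ z, ENNReal.ofReal (g z.1 z.2 * testFunction k N T R z.1 z.2)
      ∂spacetimeMeasure n) + ENNReal.ofReal δ ≤ X := by
    intro N hN
    have heq := hsol (testFunction k N T R) (contDiff_testFunction k N T R)
      (hasCompactSupport_testFunction k N hT0 hR0)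
    have hgi := integrable_mul_testFunction hg k N hT0 hR0
    have hfun : testFunction (n := n) k N T R 0 = fun x => dyadicProfile N (R⁻¹ • x) :=
      funext fun x => testFunction_zero k N T R x
    simp only [deriv_testFunction_zero, sub_zero, hfun] at heq
    rw [(hf (fun x => dyadicProfile N (R⁻¹ • x)) ((contDiff_dyadicProfile N).comp (contDiff_const_smul R⁻¹))
      ((hasCompactSupport_dyadicProfile N).comp_homeomorph
        (Homeomorph.smulOfNeZero R⁻¹ (by positivity)))).2] at heq
    have hA : ∫ t in Ici (0 : ℝ), ∫ x, g t x * testFunction k N T R t x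
        = ∫ z, g z.1 z.2 * testFunction k N T R z.1 z.2 ∂spacetimeMeasure n :=
      (integral_prod _ hgi).symm
    rw [hA] at heq
    have hnn : ∀ z : ℝ × EuclideanSpace ℝ (Fin n),
        0 ≤ g z.1 z.2 * testFunction k N T R z.1 z.2 := fun z =>
      mul_nonneg (hg0 _ _) (testFunction_nonneg _ _ _ _ _ _)
    rw [← ofReal_integral_eq_lintegral_ofReal hgi (.of_forall hnn),
      ← ENNReal.ofReal_add (integral_nonneg hnn) (by positivity)]
    refine (ENNReal.ofReal_le_ofReal (show _ ≤ _ by linarith [hRv N hN, hRf N hN, heq])).trans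
      (?_ : ENNReal.ofReal (∫ t in Ici (0 : ℝ), ∫ x, u t x *
        (iteratedDeriv 2 (fun s => testFunction k N T R s x) t
          + fracLaplacian σ (testFunction k N T R t) x
          - deriv (fun s => testFunction k N T R s x) t
          - fracLaplacian σ (fun y => deriv (fun s => testFunction k N T R s y) t) x)) ≤ X)
    have hmeas : AEMeasurable (fun z : ℝ × EuclideanSpace ℝ (Fin n) =>
        ENNReal.ofReal (|u z.1 z.2| * spacetimeWeight k T R z)) (spacetimeMeasure n) :=
      (hu.aemeasurable.abs.mul
        (continuous_spacetimeWeight k T R).measurable.aemeasurable).ennreal_ofReal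
    rw [hX, spacetimeMeasure, lintegral_prod _ hmeas, ← lintegral_const_mul' _ _
      ENNReal.ofReal_ne_top]
    refine (Real.ofReal_le_enorm _).trans ((enorm_integral_le_lintegral_enorm _).trans ?_)
    refine lintegral_mono fun t => ?_
    refine (enorm_integral_le_lintegral_enorm _).trans ?_
    rw [← lintegral_const_mul' _ _ ENNReal.ofReal_ne_top]
    refine lintegral_mono fun x => ?_
    rw [← ENNReal.ofReal_mul (by positivity), ← ofReal_norm, norm_mul, Real.norm_eq_abs,
      Real.norm_eq_abs]
    refine ENNReal.ofReal_le_ofReal ?_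
    have := mul_le_mul_of_nonneg_left (hK N R hR1 t x) (abs_nonneg (u t x))
    linarith
  -- the bound holds for every `N`; pass to the limit
  have hlim : ENNReal.ofReal ((1 / 2) ^ (n + 1)) * (∫⁻ z, ENNReal.ofReal
      (g z.1 z.2 * spacetimeWeight (k + 2) T R z) ∂spacetimeMeasure n)
      ≤ X - ENNReal.ofReal δ := by
    rw [← lintegral_const_mul' _ _ ENNReal.ofReal_ne_top]
    calc _ ≤ ∫⁻ z, liminf (fun N => ENNReal.ofReal
            (g z.1 z.2 * testFunction k N T R z.1 z.2)) atTop ∂spacetimeMeasure n := by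
          refine lintegral_mono fun z => ?_
          rw [← ENNReal.ofReal_mul (by positivity)]
          obtain ⟨N₀, hN₀⟩ := exists_le_dyadicProfile (R⁻¹ • z.2)
          refine le_liminf_of_le (by isBoundedDefault) ?_
          filter_upwards [eventually_ge_atTop N₀] with N hN
          refine ENNReal.ofReal_le_ofReal ?_
          have h1 := mul_le_mul_of_nonneg_left (hN₀ N hN)
            (mul_nonneg (hg0 z.1 z.2) (pow_nonneg (timeBump.nonneg (x := T⁻¹ * z.1)) (k + 2)))
          unfold spacetimeWeight testFunction
          linarith
      _ ≤ liminf (fun N => ∫⁻ z, ENNReal.ofReal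
            (g z.1 z.2 * testFunction k N T R z.1 z.2) ∂spacetimeMeasure n) atTop :=
          lintegral_liminf_le' fun N =>
            (integrable_mul_testFunction hg k N hT0 hR0).aemeasurable.ennreal_ofReal
      _ ≤ _ := by
          refine liminf_le_of_frequently_le' (Eventually.frequently ?_)
          filter_upwards [eventually_ge_atTop 1] with N hN
          exact ENNReal.le_sub_of_add_le_right ENNReal.ofReal_ne_top (hXN N hN)
  have hδX : ENNReal.ofReal δ ≤ X := le_add_self.trans (hXN 1 le_rfl)
  calc _ ≤ X - ENNReal.ofReal δ + ENNReal.ofReal δ := by gcongr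
    _ = X := tsub_add_cancel_of_le hδX

theorem spacetimeWeight_le_indicator {k : ℕ} (hk : k ≠ 0) {T R : ℝ} (hT : 0 < T)
    (z : ℝ × EuclideanSpace ℝ (Fin n)) :
    spacetimeWeight k T R z
      ≤ (Iic (2 * T)).indicator (fun _ => (1 : ℝ)) z.1 * polyWeight (R⁻¹ • z.2) := by
  unfold spacetimeWeight
  refine mul_le_mul_of_nonneg_right ?_ (polyWeight_pos _).le
  by_cases hz : z.1 ∈ Iic (2 * T)
  · rw [indicator_of_mem hz]
    exact pow_le_one₀ timeBump.nonneg timeBump.le_one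
  · rw [indicator_of_notMem hz, timeBump.zero_of_le_dist, zero_pow hk]
    have h : 2 * T < z.1 := not_le.1 hz
    have h1 : 2 ≤ T⁻¹ * z.1 := by
      rw [le_inv_mul_iff₀ hT]; linarith
    simpa [timeBump] using h1.trans (le_abs_self _)

theorem lintegral_indicator_mul_polyWeight {T R : ℝ} (hT : 0 < T) (hR : 0 < R) :
    ∫⁻ z : ℝ × EuclideanSpace ℝ (Fin n), ENNReal.ofReal
      ((Iic (2 * T)).indicator (fun _ => (1 : ℝ)) z.1 * polyWeight (R⁻¹ • z.2))
        ∂spacetimeMeasure n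
      = ENNReal.ofReal (2 * T * (R ^ n * ∫ x : EuclideanSpace ℝ (Fin n), polyWeight x)) := by
  have hW : Integrable fun x : EuclideanSpace ℝ (Fin n) => polyWeight (R⁻¹ • x) :=
    integrable_polyWeight.comp_smul (by positivity)
  have h2 : ∫⁻ x : EuclideanSpace ℝ (Fin n), ENNReal.ofReal (polyWeight (R⁻¹ • x))
      = ENNReal.ofReal (R ^ n * ∫ x : EuclideanSpace ℝ (Fin n), polyWeight x) := by
    rw [← ofReal_integral_eq_lintegral_ofReal hW (.of_forall fun x => (polyWeight_pos _).le),
      Measure.integral_comp_inv_smul_of_nonneg _ _ hR.le, finrank_euclideanSpace_fin, smul_eq_mul]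
  have h1 : ∫⁻ t in Ici (0 : ℝ), ENNReal.ofReal ((Iic (2 * T)).indicator (fun _ => (1 : ℝ)) t)
      = ENNReal.ofReal (2 * T) := by
    have : (fun t : ℝ => ENNReal.ofReal ((Iic (2 * T)).indicator (fun _ => (1 : ℝ)) t))
        = (Iic (2 * T)).indicator fun _ => (1 : ENNReal) := by
      funext t
      by_cases ht : t ∈ Iic (2 * T) <;> simp [indicator, ht]
    rw [this, lintegral_indicator measurableSet_Iic, Measure.restrict_restrict measurableSet_Iic,
      inter_comm, Ici_inter_Iic]
    simp
  rw [ENNReal.ofReal_mul (by positivity), ← h1, ← h2, spacetimeMeasure,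
    ← lintegral_prod_mul]
  · refine lintegral_congr fun z => ?_
    exact ENNReal.ofReal_mul (indicator_nonneg (fun _ _ => zero_le_one) _)
  · exact ((measurable_const.indicator measurableSet_Iic).ennreal_ofReal).aemeasurable
  · exact hW.aemeasurable.ennreal_ofReal

/-- Hölder's inequality. The condition `k + 2 ≤ p k` means `β^k ≤ (β^{k+2})^{1/p}`, so that the loss of
two powers of the cutoff is absorbed. -/
theorem lintegral_mul_spacetimeWeight_le {u : ℝ → EuclideanSpace ℝ (Fin n) → ℝ}
    (hu : AEStronglyMeasurable (Function.uncurry u) (spacetimeMeasure n)) {p : ℝ} (hp : 1 < p)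
    {k : ℕ} (hk : (k + 2 : ℝ) ≤ p * k) {T R : ℝ} (hT : 0 < T) (hR : 0 < R) :
    ∫⁻ z, ENNReal.ofReal (|u z.1 z.2| * spacetimeWeight k T R z) ∂spacetimeMeasure n
      ≤ (∫⁻ z, ENNReal.ofReal (|u z.1 z.2| ^ p * spacetimeWeight (k + 2) T R z)
          ∂spacetimeMeasure n) ^ (1 / p)
        * ENNReal.ofReal (2 * T * (R ^ n * ∫ x : EuclideanSpace ℝ (Fin n), polyWeight x))
          ^ (1 - 1 / p) := by
  have hp0 : 0 < p := by linarith
  have hpq := Real.HolderConjugate.conjExponent hp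
  set q := p.conjExponent with hq
  have hq0 : 0 < q := hpq.symm.pos
  have hqi : 1 - 1 / p = 1 / q := by
    have := hpq.inv_add_inv_eq_one
    rw [one_div, one_div]; linarith
  have hk0 : k ≠ 0 := by
    rintro rfl
    norm_num at hk
  set χ : ℝ × EuclideanSpace ℝ (Fin n) → ℝ := fun z =>
    (Iic (2 * T)).indicator (fun _ => (1 : ℝ)) z.1 * polyWeight (R⁻¹ • z.2) with hχ
  have hχ0 : ∀ z, 0 ≤ χ z := fun z =>
    mul_nonneg (indicator_nonneg (fun _ _ => zero_le_one) _) (polyWeight_pos _).le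
  have hχm : Measurable χ :=
    ((measurable_const.indicator measurableSet_Iic).comp measurable_fst).mul
      ((continuous_polyWeight.comp (continuous_const_smul R⁻¹)).measurable.comp measurable_snd)
  have hpt : ∀ z : ℝ × EuclideanSpace ℝ (Fin n), spacetimeWeight k T R z
      ≤ spacetimeWeight (k + 2) T R z ^ (1 / p) * χ z ^ (1 / q) := by
    intro z
    have hW := polyWeight_pos (R⁻¹ • z.2)
    rcases (timeBump.nonneg (x := T⁻¹ * z.1)).eq_or_lt' with h0 | h0
    · rw [spacetimeWeight, h0, zero_pow hk0, zero_mul]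
      exact mul_nonneg (Real.rpow_nonneg (spacetimeWeight_nonneg _ _ _ _) _)
        (Real.rpow_nonneg (hχ0 z) _)
    · have hz : z.1 ∈ Iic (2 * T) := by
        by_contra hz
        have := spacetimeWeight_le_indicator (R := R) one_ne_zero hT z
        rw [indicator_of_notMem hz, zero_mul, spacetimeWeight, pow_one] at this
        exact absurd this (not_le.2 (mul_pos h0 hW))
      simp only [hχ, spacetimeWeight]
      rw [indicator_of_mem hz, one_mul, Real.mul_rpow (by positivity) hW.le, mul_assoc,
        ← Real.rpow_add hW]
      have h1 : 1 / p + 1 / q = 1 := by linarith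
      rw [h1, Real.rpow_one, ← Real.rpow_natCast _ k, ← Real.rpow_natCast _ (k + 2),
        ← Real.rpow_mul h0.le]
      refine mul_le_mul_of_nonneg_right ?_ hW.le
      refine Real.rpow_le_rpow_of_exponent_ge h0 timeBump.le_one ?_
      push_cast
      rw [mul_one_div, div_le_iff₀ hp0]
      linarith
  calc _ ≤ ∫⁻ z, ((fun z => ENNReal.ofReal
            (|u z.1 z.2| * spacetimeWeight (k + 2) T R z ^ (1 / p)))
          * fun z => ENNReal.ofReal (χ z ^ (1 / q))) z ∂spacetimeMeasure n := by
        refine lintegral_mono fun z => ?_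
        simp only [Pi.mul_apply]
        rw [← ENNReal.ofReal_mul (mul_nonneg (abs_nonneg _)
          (Real.rpow_nonneg (spacetimeWeight_nonneg _ _ _ _) _)), mul_assoc]
        exact ENNReal.ofReal_le_ofReal (mul_le_mul_of_nonneg_left (hpt z) (abs_nonneg _))
    _ ≤ _ := by
        refine (ENNReal.lintegral_mul_le_Lp_mul_Lq _ hpq ?_ ?_).trans (le_of_eq ?_)
        · exact (hu.aemeasurable.abs.mul ((continuous_spacetimeWeight _ T R).measurable.pow_const
            _).aemeasurable).ennreal_ofReal
        · exact (hχm.pow_const _).ennreal_ofReal.aemeasurable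
        · rw [hqi, ← lintegral_indicator_mul_polyWeight hT hR]
          congr 2
          · refine lintegral_congr fun z => ?_
            have hw := spacetimeWeight_nonneg (k + 2) T R z
            rw [ENNReal.ofReal_rpow_of_nonneg (by positivity) hp0.le,
              Real.mul_rpow (abs_nonneg _) (by positivity), ← Real.rpow_mul hw,
              one_div_mul_cancel hp0.ne', Real.rpow_one]
          · refine lintegral_congr fun z => ?_
            rw [ENNReal.ofReal_rpow_of_nonneg (Real.rpow_nonneg (hχ0 z) _) hq0.le,
              ← Real.rpow_mul (hχ0 z), one_div_mul_cancel hq0.ne', Real.rpow_one]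

/-- Continuity in `L²` bounds the `L²` norms on the compact time interval `[0, 2T]` that carries the
weight. -/
theorem IsContinuousL2Curve.lintegral_mul_spacetimeWeight_lt_top
    {u : ℝ → EuclideanSpace ℝ (Fin n) → ℝ} (hc : IsContinuousL2Curve u)
    (hu : AEStronglyMeasurable (Function.uncurry u) (spacetimeMeasure n))
    {k : ℕ} (hk : k ≠ 0) {T R : ℝ} (hT : 0 < T) (hR : 0 < R) :
    ∫⁻ z, ENNReal.ofReal (|u z.1 z.2| * spacetimeWeight k T R z) ∂spacetimeMeasure n < ⊤ := by
  obtain ⟨U, hUc, hU⟩ := hc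
  obtain ⟨B, hB⟩ := (isCompact_Icc (a := (0 : ℝ)) (b := 2 * T)).exists_bound_of_continuousOn
    (hUc.mono Icc_subset_Ici_self)
  set χ : ℝ → ℝ := (Iic (2 * T)).indicator (fun _ => (1 : ℝ)) with hχ
  have hχ0 : ∀ t, 0 ≤ χ t := fun t => indicator_nonneg (fun _ _ => zero_le_one) _
  have hχm : Measurable χ := measurable_const.indicator measurableSet_Iic
  have hpt : ∀ z : ℝ × EuclideanSpace ℝ (Fin n),
      |u z.1 z.2| * spacetimeWeight k T R z
        ≤ χ z.1 * u z.1 z.2 ^ 2 + χ z.1 * polyWeight (R⁻¹ • z.2) := by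
    intro z
    have h1 := mul_le_mul_of_nonneg_left (spacetimeWeight_le_indicator (R := R) hk hT z)
      (abs_nonneg (u z.1 z.2))
    have hW := polyWeight_pos (R⁻¹ • z.2)
    have hW1 := polyWeight_le_one (R⁻¹ • z.2)
    have h2 : |u z.1 z.2| * polyWeight (R⁻¹ • z.2)
        ≤ u z.1 z.2 ^ 2 + polyWeight (R⁻¹ • z.2) := by
      have h3 := sq_nonneg (|u z.1 z.2| - polyWeight (R⁻¹ • z.2))
      have h4 := sq_abs (u z.1 z.2)
      nlinarith [abs_nonneg (u z.1 z.2)]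
    have h3 := mul_le_mul_of_nonneg_left h2 (hχ0 z.1)
    change _ ≤ |u z.1 z.2| * (χ z.1 * _) at h1
    linarith
  have hm : AEMeasurable (fun z : ℝ × EuclideanSpace ℝ (Fin n) =>
      ENNReal.ofReal (χ z.1 * u z.1 z.2 ^ 2)) (spacetimeMeasure n) :=
    ((hχm.comp measurable_fst).aemeasurable.mul (hu.aemeasurable.pow_const 2)).ennreal_ofReal
  have hsq : ∫⁻ z, ENNReal.ofReal (χ z.1 * u z.1 z.2 ^ 2) ∂spacetimeMeasure n
      ≤ ENNReal.ofReal (B ^ 2) * ENNReal.ofReal (2 * T) := by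
    rw [spacetimeMeasure, lintegral_prod _ hm]
    calc _ ≤ ∫⁻ t in Ici (0 : ℝ), (Iic (2 * T)).indicator
            (fun _ => ENNReal.ofReal (B ^ 2)) t := by
          refine setLIntegral_mono' measurableSet_Ici fun t ht => ?_
          by_cases htT : t ∈ Iic (2 * T)
          · have hL : ∫⁻ x, ENNReal.ofReal (u t x ^ 2) = ‖U t‖ₑ ^ (2 : ℝ) := by
              have h1 := eLpNorm_nnreal_pow_eq_lintegral (μ := volume) (f := U t) (p := 2)
                (by norm_num)
              rw [Lp.enorm_def]
              refine Eq.trans ?_ h1.symm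
              refine lintegral_congr_ae ?_
              filter_upwards [hU t ht] with x hx
              rw [← hx, ← sq_abs, ← Real.norm_eq_abs, ENNReal.ofReal_pow (norm_nonneg _),
                ofReal_norm]
              norm_num
            simp only [hχ, indicator_of_mem htT, one_mul, hL]
            rw [← ofReal_norm, ENNReal.ofReal_rpow_of_nonneg (norm_nonneg _) zero_le_two]
            refine ENNReal.ofReal_le_ofReal ?_
            rw [Real.rpow_two]
            exact pow_le_pow_left₀ (norm_nonneg _) (hB t ⟨ht, htT⟩) 2
          · simp [hχ, indicator_of_notMem htT]
      _ = _ := by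
          rw [lintegral_indicator measurableSet_Iic, Measure.restrict_restrict measurableSet_Iic,
            inter_comm, Ici_inter_Iic]
          simp
  calc _ ≤ ∫⁻ z, (ENNReal.ofReal (χ z.1 * u z.1 z.2 ^ 2)
          + ENNReal.ofReal (χ z.1 * polyWeight (R⁻¹ • z.2))) ∂spacetimeMeasure n :=
        lintegral_mono fun z => (ENNReal.ofReal_le_ofReal (hpt z)).trans ENNReal.ofReal_add_le
    _ = (∫⁻ z, ENNReal.ofReal (χ z.1 * u z.1 z.2 ^ 2) ∂spacetimeMeasure n)
        + ∫⁻ z, ENNReal.ofReal (χ z.1 * polyWeight (R⁻¹ • z.2)) ∂spacetimeMeasure n :=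
        lintegral_add_left' hm _
    _ < ⊤ := by
        refine ENNReal.add_lt_top.2 ⟨hsq.trans_lt ?_, ?_⟩
        · exact ENNReal.mul_lt_top ENNReal.ofReal_lt_top ENNReal.ofReal_lt_top
        · rw [lintegral_indicator_mul_polyWeight hT hR]
          exact ENNReal.ofReal_lt_top

end WeightedIntegrals

/-! ### The cyclic system of inequalities -/

section CyclicSystem

open Filter

variable {k : ℕ} [NeZero k]

theorem exponentMatrix_sub_one_mulVec (p v : Fin k → ℝ) (ℓ : Fin k) :
    ((exponentMatrix p - 1) *ᵥ v) ℓ = p ℓ * v (ℓ - 1) - v ℓ := by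
  rw [Matrix.sub_mulVec, Matrix.one_mulVec]
  simp [exponentMatrix, Matrix.mulVec, dotProduct]

/-- A kernel vector `v` of `P - I` has `v_{ℓ+1} = p_{ℓ+1} v_ℓ`, which is impossible at its largest entry
unless `v = 0`. -/
theorem det_exponentMatrix_sub_one_ne_zero {p : Fin k → ℝ} (hp : ∀ ℓ, 1 < p ℓ) :
    (exponentMatrix p - 1).det ≠ 0 := by
  intro hdet
  obtain ⟨v, hv0, hv⟩ := Matrix.exists_mulVec_eq_zero_iff.2 hdet
  obtain ⟨m, hm⟩ := Finite.exists_max fun ℓ => |v ℓ|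
  have h := congrFun hv (m + 1)
  rw [exponentMatrix_sub_one_mulVec, add_sub_cancel_right, Pi.zero_apply, sub_eq_zero] at h
  have h1 : p (m + 1) * |v m| ≤ |v m| := by
    rw [← abs_of_pos (zero_lt_one.trans (hp (m + 1))), ← abs_mul, h]
    exact hm _
  have h2 : |v m| = 0 := by
    by_contra h0
    have := lt_of_le_of_ne (abs_nonneg (v m)) (Ne.symm h0)
    nlinarith [hp (m + 1)]
  exact hv0 (funext fun ℓ => abs_eq_zero.1 (le_antisymm (h2 ▸ hm ℓ) (abs_nonneg _)))

/-- The rows of `(P - I)γ = (1, …, 1)ᵗ`. -/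
theorem mul_gammaVec_sub {p : Fin k → ℝ} (hp : ∀ ℓ, 1 < p ℓ) (ℓ : Fin k) :
    p (ℓ + 1) * gammaVec p ℓ - gammaVec p (ℓ + 1) = 1 := by
  have h : (exponentMatrix p - 1) *ᵥ gammaVec p = fun _ => 1 := by
    rw [gammaVec, Matrix.mulVec_mulVec, Matrix.mul_nonsing_inv _
      (det_exponentMatrix_sub_one_ne_zero hp).isUnit, Matrix.one_mulVec]
  have := congrFun h (ℓ + 1)
  rwa [exponentMatrix_sub_one_mulVec, add_sub_cancel_right] at this

theorem le_rpow_of_le_mul_rpow {D Z s : ℝ} (hD : 0 ≤ D) (hZ : 0 ≤ Z) (hs : s < 1)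
    (h : Z ≤ D * Z ^ s) : Z ≤ D ^ (1 - s)⁻¹ := by
  have hs' : 0 < 1 - s := by linarith
  rcases hZ.eq_or_lt with rfl | hZ
  · positivity
  · rw [Real.le_rpow_inv_iff_of_pos hZ.le hD hs', Real.rpow_sub hZ, Real.rpow_one,
      div_le_iff₀ (by positivity)]
    exact h

/-- A cyclic system `Z_ℓ ≤ D_ℓ Z_{ℓ+1}^{1/p_{ℓ+1}}` with exponents `p_ℓ > 1` has only bounded solutions,
with a bound that depends on `D` and `p` alone: look at the largest `Z_ℓ`. -/
theorem exists_bound_of_cyclic_le {p D : Fin k → ℝ} (hp : ∀ ℓ, 1 < p ℓ) (hD : ∀ ℓ, 0 ≤ D ℓ) :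
    ∃ B, ∀ Z : Fin k → ℝ, (∀ ℓ, 0 ≤ Z ℓ) → (∀ ℓ, Z ℓ ≤ D ℓ * Z (ℓ + 1) ^ (1 / p (ℓ + 1))) →
      ∀ ℓ, Z ℓ ≤ B := by
  refine ⟨∑ ℓ, D ℓ ^ (1 - 1 / p (ℓ + 1))⁻¹, fun Z hZ0 hZ => ?_⟩
  obtain ⟨m, hm⟩ := Finite.exists_max Z
  have hpm := hp (m + 1)
  have h1 : Z m ≤ D m * Z m ^ (1 / p (m + 1)) := (hZ m).trans
    (mul_le_mul_of_nonneg_left (Real.rpow_le_rpow (hZ0 _) (hm _) (by positivity)) (hD m))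
  have h2 := le_rpow_of_le_mul_rpow (hD m) (hZ0 m)
    (by rw [div_lt_one (by linarith)]; exact hpm) h1
  exact fun ℓ => (hm ℓ).trans (h2.trans (Finset.single_le_sum
    (f := fun ℓ => D ℓ ^ (1 - 1 / p (ℓ + 1))⁻¹)
    (fun ℓ _ => Real.rpow_nonneg (hD ℓ) _) (Finset.mem_univ m)))

/-- The scaling argument: the inequalities between the weighted integrals `x_ℓ` cannot hold for all
large `R` if `2σγ_m > n` for some `m`. -/
theorem not_eventually_scaled_cyclic_le {n : ℕ} {σ M : ℝ} (hM : 0 ≤ M)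
    {p γ c δ K : Fin k → ℝ} (hp : ∀ ℓ, 1 < p ℓ)
    (hγ : ∀ ℓ, p (ℓ + 1) * γ ℓ - γ (ℓ + 1) = 1) (hc : ∀ ℓ, 0 < c ℓ) (hδ : ∀ ℓ, 0 < δ ℓ)
    (hK : ∀ ℓ, 0 ≤ K ℓ) {m : Fin k} (hm : (n : ℝ) < 2 * σ * γ m) :
    ¬ ∀ᶠ R : ℝ in atTop, ∃ x : Fin k → ℝ, (∀ ℓ, 0 ≤ x ℓ) ∧ ∀ ℓ,
      c ℓ * x ℓ + δ ℓ ≤ K ℓ * (R ^ (2 * σ))⁻¹ *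
        (x (ℓ + 1) ^ (1 / p (ℓ + 1)) * (2 * R ^ (2 * σ) * (R ^ n * M)) ^ (1 - 1 / p (ℓ + 1))) := by
  intro hev
  set A : Fin k → ℝ := fun ℓ => K ℓ * (2 * M) ^ (1 - 1 / p (ℓ + 1)) with hA
  have hA0 : ∀ ℓ, 0 ≤ A ℓ := fun ℓ => mul_nonneg (hK ℓ) (by positivity)
  obtain ⟨B, hB⟩ := exists_bound_of_cyclic_le (D := fun ℓ => A ℓ / c ℓ) hp
    fun ℓ => div_nonneg (hA0 ℓ) (hc ℓ).le
  have hlarge := ((tendsto_rpow_atTop (sub_pos.2 hm)).const_mul_atTop (hδ m)).eventually_gt_atTop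
    (A m * max B 0 ^ (1 / p (m + 1)))
  obtain ⟨R, ⟨x, hx0, hx⟩, hR, hRpos⟩ := (hev.and (hlarge.and (eventually_gt_atTop 0))).exists
  -- in terms of `Z` the constants no longer depend on `R`
  set Z : Fin k → ℝ := fun ℓ => x ℓ * R ^ (2 * σ * γ ℓ - n) with hZ
  have hZ0 : ∀ ℓ, 0 ≤ Z ℓ := fun ℓ => mul_nonneg (hx0 ℓ) (by positivity)
  have hZle : ∀ ℓ, c ℓ * Z ℓ + δ ℓ * R ^ (2 * σ * γ ℓ - n)
      ≤ A ℓ * Z (ℓ + 1) ^ (1 / p (ℓ + 1)) := by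
    intro ℓ
    have hp0 : 0 < p (ℓ + 1) := zero_lt_one.trans (hp _)
    have h := mul_le_mul_of_nonneg_right (hx ℓ)
      (show 0 ≤ R ^ (2 * σ * γ ℓ - n) by positivity)
    have hbase : 2 * R ^ (2 * σ) * (R ^ n * M) = 2 * M * R ^ (2 * σ + n) := by
      rw [Real.rpow_add hRpos, Real.rpow_natCast]; ring
    -- the exponents of `R` agree by the equation for `γ`
    have hpow : (R ^ (2 * σ))⁻¹ * (R ^ (2 * σ + n)) ^ (1 - 1 / p (ℓ + 1))
        * R ^ (2 * σ * γ ℓ - n) = (R ^ (2 * σ * γ (ℓ + 1) - n)) ^ (1 / p (ℓ + 1)) := by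
      rw [← Real.rpow_neg hRpos.le, ← Real.rpow_mul hRpos.le, ← Real.rpow_mul hRpos.le,
        ← Real.rpow_add hRpos, ← Real.rpow_add hRpos]
      congr 1
      have h3 : γ (ℓ + 1) = p (ℓ + 1) * γ ℓ - 1 := by linarith [hγ ℓ]
      rw [h3]
      field_simp
      ring
    simp only [hZ, hA]
    rw [Real.mul_rpow (hx0 _) (by positivity), ← hpow]
    rw [hbase, Real.mul_rpow (by positivity) (by positivity)] at h
    linarith
  have hZB := hB Z hZ0 fun ℓ => by
    have h1 := hZle ℓ
    have h2 : 0 ≤ δ ℓ * R ^ (2 * σ * γ ℓ - n) := mul_nonneg (hδ ℓ).le (by positivity)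
    rw [div_mul_eq_mul_div, le_div_iff₀ (hc ℓ)]
    linarith
  have h1 := hZle m
  have h2 : 0 ≤ c m * Z m := mul_nonneg (hc m).le (hZ0 m)
  have h3 : A m * Z (m + 1) ^ (1 / p (m + 1)) ≤ A m * max B 0 ^ (1 / p (m + 1)) :=
    mul_le_mul_of_nonneg_left (Real.rpow_le_rpow (hZ0 _) ((hZB _).trans (le_max_left _ _))
      (by have := hp (m + 1); positivity)) (hA0 m)
  linarith

end CyclicSystem

/-! ### Nonexistence of global solutions -/

theorem theorem1p2 {n k : ℕ} [NeZero k] (hn : 1 ≤ n) (hk : 2 ≤ k)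
    (σ : ℝ) (hσ : 1 ≤ σ)
    (p : Fin k → ℝ) (hp : ∀ ℓ, 1 < p ℓ)
    (hγ : ∃ m, (n : ℝ) / (2 * σ) < gammaVec p m)
    (u0 u1 f0 : Fin k → EuclideanSpace ℝ (Fin n) → ℝ)
    (hf0 : ∀ ℓ, IsDistribHelmholtz σ (u0 ℓ) (f0 ℓ))
    (hf0_int : ∀ ℓ, Integrable (f0 ℓ)) (hu1_int : ∀ ℓ, Integrable (u1 ℓ))
    (hf0_pos : ∀ ℓ, 0 < ∫ x, f0 ℓ x) (hu1_pos : ∀ ℓ, 0 < ∫ x, u1 ℓ x) :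
    ¬ ∃ u : Fin k → ℝ → EuclideanSpace ℝ (Fin n) → ℝ,
      IsGlobalSobolevSolution σ p u0 u1 u := by
  rintro ⟨u, hu⟩
  obtain ⟨m, hm⟩ := hγ
  have hmeas : ∀ ℓ, AEStronglyMeasurable (Function.uncurry (u ℓ)) (spacetimeMeasure n) :=
    fun ℓ => volume_restrict_eq_spacetimeMeasure (n := n) ▸ hu.measurable ℓ
  -- one power of the time cutoff that serves all exponents: `κ ≥ 2 / (p ℓ - 1)`
  obtain ⟨κ, hκ⟩ := exists_nat_ge (∑ ℓ, 2 / (p ℓ - 1))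
  have hκp : ∀ ℓ, (κ + 2 : ℝ) ≤ p ℓ * κ := by
    intro ℓ
    have hpℓ : 0 < p ℓ - 1 := sub_pos.2 (hp ℓ)
    have h1 : 2 / (p ℓ - 1) ≤ κ := (Finset.single_le_sum (f := fun ℓ => 2 / (p ℓ - 1))
      (fun ℓ _ => div_nonneg zero_le_two (sub_pos.2 (hp ℓ)).le) (Finset.mem_univ ℓ)).trans hκ
    rw [div_le_iff₀ hpℓ] at h1
    linarith
  have hκ0 : κ ≠ 0 := by
    rintro rfl
    have := hκp m
    norm_num at this
  choose K δ hK0 hδ hev using fun ℓ => (hu.equation ℓ).exists_weighted_le hσ κ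
    (fun t x => by positivity) (hu.nonlinearity_locallyIntegrable ℓ) (hmeas ℓ) (hf0 ℓ)
    (hf0_int ℓ) (hu1_int ℓ) (hf0_pos ℓ) (hu1_pos ℓ)
  have hM : 0 ≤ ∫ x : EuclideanSpace ℝ (Fin n), polyWeight x :=
    integral_nonneg fun x => (polyWeight_pos x).le
  refine not_eventually_scaled_cyclic_le (n := n) (σ := σ) hM hp (mul_gammaVec_sub hp)
    (c := fun _ => (1 / 2) ^ (n + 1)) (fun _ => by positivity) hδ hK0 (m := m) ?_ ?_
  · rwa [div_lt_iff₀' (by linarith)] at hm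
  · filter_upwards [Filter.eventually_all.2 hev, Filter.eventually_gt_atTop 0] with R hR hR0
    set T := R ^ (2 * σ) with hT
    have hT0 : 0 < T := by positivity
    set I : Fin k → ENNReal := fun ℓ => ∫⁻ z, ENNReal.ofReal
      (|u (ℓ - 1) z.1 z.2| ^ p ℓ * spacetimeWeight (κ + 2) T R z) ∂spacetimeMeasure n with hI
    set J : Fin k → ENNReal := fun ℓ => ∫⁻ z, ENNReal.ofReal
      (|u ℓ z.1 z.2| * spacetimeWeight κ T R z) ∂spacetimeMeasure n with hJ
    have hJtop : ∀ ℓ, J ℓ < ⊤ := fun ℓ =>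
      (hu.continuous ℓ).lintegral_mul_spacetimeWeight_lt_top (hmeas ℓ) hκ0 hT0 hR0
    have hItop : ∀ ℓ, I ℓ ≠ ⊤ := by
      intro ℓ htop
      have h1 : ENNReal.ofReal ((1 / 2) ^ (n + 1)) * I ℓ < ⊤ :=
        (le_self_add.trans (hR ℓ)).trans_lt (ENNReal.mul_lt_top ENNReal.ofReal_lt_top (hJtop ℓ))
      rw [htop, ENNReal.mul_top (by simp)] at h1
      exact h1.ne rfl
    have hJI : ∀ ℓ, J ℓ ≤ I (ℓ + 1) ^ (1 / p (ℓ + 1)) * ENNReal.ofReal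
        (2 * T * (R ^ n * ∫ x : EuclideanSpace ℝ (Fin n), polyWeight x))
          ^ (1 - 1 / p (ℓ + 1)) := by
      intro ℓ
      have := lintegral_mul_spacetimeWeight_le (hmeas ℓ) (hp (ℓ + 1)) (hκp (ℓ + 1)) hT0 hR0
      simpa only [hI, hJ, add_sub_cancel_right] using this
    refine ⟨fun ℓ => (I ℓ).toReal, fun ℓ => ENNReal.toReal_nonneg, fun ℓ => ?_⟩
    have hs : 0 ≤ 1 - 1 / p (ℓ + 1) := by
      rw [sub_nonneg, div_le_one (by linarith [hp (ℓ + 1)])]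
      exact (hp _).le
    have hr : 0 ≤ 1 / p (ℓ + 1) := by have := hp (ℓ + 1); positivity
    have h := (hR ℓ).trans (mul_le_mul_right (hJI ℓ) _)
    have h' := ENNReal.toReal_mono (ENNReal.mul_ne_top ENNReal.ofReal_ne_top
      (ENNReal.mul_ne_top (ENNReal.rpow_ne_top_of_nonneg hr (hItop _))
        (ENNReal.rpow_ne_top_of_nonneg hs ENNReal.ofReal_ne_top))) h
    rw [ENNReal.toReal_add (ENNReal.mul_ne_top ENNReal.ofReal_ne_top (hItop ℓ))
      ENNReal.ofReal_ne_top] at h'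
    simp only [ENNReal.toReal_mul, ← ENNReal.toReal_rpow] at h'
    rwa [ENNReal.toReal_ofReal (by positivity), ENNReal.toReal_ofReal (hδ ℓ).le,
      ENNReal.toReal_ofReal (mul_nonneg (hK0 ℓ) (by positivity)),
      ENNReal.toReal_ofReal (by positivity)] at h'
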